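/- **The $k$-cop-move game.** Let $G$ be a graph. In the $k$-cop-move game with $c$ cops on $G$, the cops' player first places $c$ cops on vertices of $G$, then the other player places the robber on a vertex. After that the two players alternate, the cops moving first. On the cops' turn at most $k$ of the cops are moved, each along one edge; on the robber's turn the robber stays or moves along one edge. All positions are always known to both players. The cops win if at some moment a cop and the robber are on the same vertex; otherwise the robber wins. The $k$-cop-move number $\mathrm{cop}_k(G)$ is the least $c$ for which the cops have a winning strategy. **The graph $\mathbb G$.** Let $B$ be the truncated icosahedron, with $60$ vertices, $90$ edges, $12$ pentagonal and $20$ hexagonal faces. The graph $\mathbb G$ has the $60$ vertices of $B$ as its *key vertices*; the edges of $B$ are not kept. Further vertices and edges are drawn inside the faces of $B$ as follows. 1. For every face $\varphi$ and every side $vw$ of $\varphi$, with ends $v,w$, there is a path of length $4$ in $\varphi$ from $v$ to $w$, with three new inner vertices: $v,\ p_{\varphi,vw},\ m_{\varphi,vw},\ p_{\varphi,wv},\ w$. 2. For every face $\varphi$ and every vertex $v$ of $\varphi$, with neighbours $w,w'$ along the boundary of $\varphi$, the vertices $p_{\varphi,vw}$ and $p_{\varphi,vw'}$ are adjacent. 3.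 For every edge $vw$ of $B$, lying on the two faces $\varphi,\varphi'$, the vertices $m_{\varphi,vw}$ and $m_{\varphi',vw}$ are adjacent. 4. Every hexagonal face $\varphi$ shares three of its sides with pentagons. For each such side $s$ there are two new vertices $e_{\varphi,s}$ and $z_{\varphi,s}$ in $\varphi$, and $m_{\varphi,s},e_{\varphi,s},z_{\varphi,s}$ is a path; the three vertices $z_{\varphi,s}$ form a triangle in the centre of $\varphi$. So there are $15$ new vertices in each pentagon and $24$ in each hexagon. **Theorem.** The graph $\mathbb G$ has $60+12\cdot 15+20\cdot 24=720$ vertices. The robber has a winning strategy in the $1$-cop-move game with $3$ cops on $\mathbb G$, and $\mathrm{cop}_1(\mathbb G)>3$. -/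

import Mathlib

/-! ### The one-cop-move game and its relatives -/

namespace CopsRobber

variable {V : Type*}

/-- A legal turn of the cops in the `k`-cop-move game with `c` cops: every cop stays where it is or
moves along an edge, and at most `k` cops move. -/
def CopStep (G : SimpleGraph V) (k : ℕ) {c : ℕ} (p q : Fin c → V) : Prop :=
  (∀ i, q i = p i ∨ G.Adj (p i) (q i)) ∧ {i | q i ≠ p i}.ncard ≤ k

/-- A legal turn of the robber: stay, or move along an edge. -/
def RobberStep (G : SimpleGraph V) (r s : V) : Prop :=
  s = r ∨ G.Adj r s

/-- A play is given by the cops' positions `C 0, C 1, …` (`C 0` is the initial placement) and the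
robber's positions `R 0, R 1, …` (`R 0` is the initial placement), in the order
`C 0, R 0, C 1, R 1, …`.  The robber is caught if at some moment a cop stands on the robber's
vertex, either after a turn of the robber or after a turn of the cops. -/
def Caught {c : ℕ} (C : ℕ → Fin c → V) (R : ℕ → V) : Prop :=
  ∃ n i, C n i = R n ∨ C (n + 1) i = R n

/-- The cops have a winning strategy in the `k`-cop-move game with `c` cops on `G`.  A strategy
`S` prescribes the cops' `n`-th configuration from the robber's positions so far. -/
def CopsWin (G : SimpleGraph V) (k c : ℕ) : Prop :=
  ∃ S : (n : ℕ) → (Fin n → V) → Fin c → V,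
    ∀ R : ℕ → V, (∀ n, RobberStep G (R n) (R (n + 1))) →
      (∀ n, CopStep G k (S n fun j => R j) (S (n + 1) fun j => R j)) ∧
        Caught (fun n => S n fun j => R j) R

/-- The robber has a winning strategy in the `k`-cop-move game with `c` cops on `G`: a rule `T`
prescribing the robber's `n`-th position from the cops' configurations so far, which is legal and
evades capture forever. -/
def RobberWins (G : SimpleGraph V) (k c : ℕ) : Prop :=
  ∃ T : (n : ℕ) → (Fin (n + 1) → Fin c → V) → V,
    ∀ C : ℕ → Fin c → V, (∀ n, CopStep G k (C n) (C (n + 1))) →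
      (∀ n, RobberStep G (T n fun j => C j) (T (n + 1) fun j => C j)) ∧
        ¬ Caught C (fun n => T n fun j => C j)

/-- The `k`-cop-move number of `G`: the least number of cops with a winning strategy
(`⊤` if there is none). -/
noncomputable def copNumber (G : SimpleGraph V) (k : ℕ) : ℕ∞ :=
  ⨅ (c : ℕ) (_ : CopsWin G k c), (c : ℕ∞)

end CopsRobber

/-! ### The truncated icosahedron -/

namespace Soccer

/-- The twelve vertices of the icosahedron: `(b, none)` are the two poles, and `(b, some i)` are the
five vertices of the ring around the pole `(b, none)`. -/
abbrev Ico : Type := Bool × Option (ZMod 5)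

/-- The icosahedron: each pole is joined to its ring, each ring is a 5-cycle, and between the rings
runs a zigzag. -/
def icosahedron : SimpleGraph Ico :=
  SimpleGraph.fromRel fun x y =>
    match x, y with
    | (b, none), (b', some _) => b = b'
    | (true, some i), (true, some j) => j = i + 1
    | (false, some i), (false, some j) => j = i + 1
    | (true, some i), (false, some j) => j = i ∨ j = i + 1
    | _, _ => False

/-- A triangular face of the icosahedron (its 3-cliques are exactly its faces). -/
abbrev Triangle : Type := {t : Finset Ico // icosahedron.IsNClique 3 t}

/-- A vertex of the truncated icosahedron: the dart `i → j` of the icosahedron stands for the vertex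
on the edge `ij` near its end `i`. -/
abbrev BVertex : Type := icosahedron.Dart

/-- The truncated icosahedron: a vertex is joined to the other vertex on the same edge of the
icosahedron, and to its two neighbours around the same (cut off) corner. -/
def B : SimpleGraph BVertex where
  Adj d e := e = d.symm ∨ (d.fst = e.fst ∧ icosahedron.Adj d.snd e.snd)
  symm := ⟨by
    rintro d e (rfl | ⟨h, h'⟩)
    · exact Or.inl (SimpleGraph.Dart.symm_symm d).symm
    · exact Or.inr ⟨h.symm, h'.symm⟩⟩
  loopless := ⟨by
    rintro d (h | ⟨-, h⟩)
    · exact SimpleGraph.Dart.symm_ne d h.symm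
    · exact icosahedron.loopless.irrefl _ h⟩

/-- The faces of the truncated icosahedron: a pentagon for every vertex and a hexagon for every
triangle of the icosahedron. -/
inductive Face : Type
  | pentagon (i : Ico)
  | hexagon (t : Triangle)

/-- The vertices on the boundary of a face: around the pentagon `i` lie the darts that start at `i`,
and around the hexagon `t` lie the six darts inside `t`. -/
def Face.verts : Face → Set BVertex
  | .pentagon i => {d | d.fst = i}
  | .hexagon t => {d | d.fst ∈ t.1 ∧ d.snd ∈ t.1}

/-- The edge `s` of the truncated icosahedron is a side of the face `φ`. -/
def Face.IsSide (φ : Face) (s : Sym2 BVertex) : Prop :=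
  s ∈ B.edgeSet ∧ ∀ v ∈ s, v ∈ φ.verts

/-- A directed side of a face: a face `φ` and an edge of `φ` directed from `v` to `w`. -/
structure DirSide : Type where
  face : Face
  dart : B.Dart
  isSide : face.IsSide dart.edge

/-- A side of a face: a face and an edge on its boundary.  Every edge is a side of two faces. -/
structure Side : Type where
  face : Face
  edge : Sym2 BVertex
  isSide : face.IsSide edge

/-- A side of a hexagon `t` that the hexagon shares with a pentagon. -/
structure HexPentSide : Type where
  hex : Triangle
  edge : Sym2 BVertex
  isSide : (Face.hexagon hex).IsSide edge
  shared : ∃ i, (Face.pentagon i).IsSide edge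

/-! ### The graph -/

/-- The vertices of the graph.
* `key v`: the vertices of the truncated icosahedron;
* `corner` and `mid`: each side `vw` of each face `φ` is replaced, inside `φ`, by a path
  `key v, corner (φ, v → w), mid (φ, vw), corner (φ, w → v), key w` of length four;
* `spoke` and `center`: inside each hexagon, for each of the three sides `vw` shared with a pentagon,
  a path `mid, spoke, center` leads from the middle of that side to one of the three
  central vertices. -/
inductive Vertex : Type
  | key (v : BVertex)
  | corner (a : DirSide)
  | mid (s : Side)
  | spoke (h : HexPentSide)
  | center (h : HexPentSide)

/-- The edges of the graph, each listed in at least one direction. -/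
inductive Link : Vertex → Vertex → Prop
  /-- The key vertex `v` and the corner vertex next to it on a side of a face. -/
  | key_corner (a : DirSide) : Link (.key a.dart.fst) (.corner a)
  /-- The two corner vertices at the same key vertex in the same face. -/
  | corner_corner (a b : DirSide) (hf : a.face = b.face) (hv : a.dart.fst = b.dart.fst)
      (hne : a ≠ b) : Link (.corner a) (.corner b)
  /-- A corner vertex and the middle of its side. -/
  | corner_mid (a : DirSide) (s : Side) (hf : a.face = s.face) (he : a.dart.edge = s.edge) :
      Link (.corner a) (.mid s)
  /-- The two middles belonging to the same edge, one in each of the two faces at that edge. -/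
  | mid_mid (s s' : Side) (he : s.edge = s'.edge) (hne : s ≠ s') : Link (.mid s) (.mid s')
  /-- From the middle of a side of a hexagon along a pentagon into the hexagon. -/
  | mid_spoke (h : HexPentSide) : Link (.mid ⟨.hexagon h.hex, h.edge, h.isSide⟩) (.spoke h)
  /-- On to the central vertex of the hexagon facing that side. -/
  | spoke_center (h : HexPentSide) : Link (.spoke h) (.center h)
  /-- The three central vertices of a hexagon form a triangle. -/
  | center_center (h h' : HexPentSide) (hx : h.hex = h'.hex) (hne : h ≠ h') :
      Link (.center h) (.center h')

/-- The graph `𝔾`. -/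
def graph : SimpleGraph Vertex := SimpleGraph.fromRel Link

end Soccer

/-! ### Generalities on the game: invariants, incompatibility of winning strategies, monotonicity -/

namespace CopsRobber

variable {V : Type*} {G : SimpleGraph V} {k c : ℕ}

/-! The robber runs from key vertex to key vertex. The invariant `Escapes` says that, without being
caught, the robber can reach a key vertex whose closed neighbourhood contains at most one cop. It
renews itself at such a vertex (`advances_of_escapes`). If no cop is near, the robber stays, since
one turn brings at most one cop near (`advances_of_forall_not`). If exactly one cop is adjacent, the
robber must run, and `advances_of_near` provides a run for all positions of the other two cops at
distance at least two.

That last claim is a finite check. The rotations of the icosahedron are transitive on its darts,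
hence on the key vertices (`exists_symmetry`), so the robber may be assumed at vertex `0`, with six
positions for the adjacent cop. For each of them a small decision tree (`Plan`) lists moves and
routes to key vertices. A route is safe if no cop is within distance `i` of its `i`-th vertex
(`clears_pathMask`); if all routes are blocked, the tree prescribes a further move. The kernel
evaluates the trees on sets of positions coded as bits of natural numbers, treating all positions of
the third cop simultaneously; `Plan.search_sound` justifies this.

The arithmetic model on `0, …, 719` is tied to the graph by a parametrization of the vertices by
twelve kinds and sixty darts (`exists_vertexOf`, `vertexOf_inj`, `graph_adj_vertexOf`). The game can
start because four key vertices with disjoint closed neighbourhoods cannot all be threatened by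
three cops. The bound on the cop number follows because parking surplus cops reduces fewer cops to
three, and both players cannot have winning strategies. -/

theorem CopStep.refl (C : Fin c → V) : CopStep G k C C := ⟨fun _ => Or.inl rfl, by simp⟩

/-- The robber wins if he can maintain an invariant `I` of the positions where he is to move. -/
theorem robberWins_of_invariant (I : V → (Fin c → V) → Prop)
    (hI : ∀ r C, I r C → ∀ i, C i ≠ r)
    (start : ∀ C : Fin c → V, ∃ r, (∀ i, C i ≠ r) ∧ ∀ C', CopStep G k C C' → I r C')
    (step : ∀ r C, I r C → ∃ s, RobberStep G r s ∧ (∀ i, C i ≠ s) ∧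
      ∀ C', CopStep G k C C' → I s C') : RobberWins G k c := by
  choose init hinit using start
  -- The response is made total, with staying as default outside the invariant, so that `choose`
  -- yields a function of the position alone.
  have step' : ∀ r C, ∃ s, I r C → RobberStep G r s ∧ (∀ i, C i ≠ s) ∧
      ∀ C', CopStep G k C C' → I s C' := by
    intro r C
    by_cases h : I r C
    · obtain ⟨s, hs⟩ := step r C h
      exact ⟨s, fun _ => hs⟩
    · exact ⟨r, fun h' => (h h').elim⟩
  choose next hnext using step'
  let T : (n : ℕ) → (Fin (n + 1) → Fin c → V) → V := fun n =>
    Nat.rec (motive := fun n => (Fin (n + 1) → Fin c → V) → V) (fun h => init (h 0))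
      (fun n ih h => next (ih fun j => h j.castSucc) (h (Fin.last _))) n
  refine ⟨T, fun C hC => ?_⟩
  have hT : ∀ n, T (n + 1) (fun j => C j) = next (T n fun j => C j) (C (n + 1)) := fun n => rfl
  -- The invariant holds when the robber is to move, so the induction carries its form half a round
  -- earlier: every legal turn of the cops leads into `I`.
  have inv : ∀ n, (∀ i, C n i ≠ T n fun j => C j) ∧
      ∀ C', CopStep G k (C n) C' → I (T n fun j => C j) C' := by
    intro n
    induction n with
    | zero => exact hinit (C 0)
    | succ n ih =>
      rw [hT]
      exact (hnext _ _ (ih.2 _ (hC n))).2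
  refine ⟨fun n => ?_, ?_⟩
  · rw [hT]
    exact (hnext _ _ ((inv n).2 _ (hC n))).1
  · rintro ⟨n, i, h | h⟩
    · exact (inv n).1 i h
    · exact hI _ _ ((inv n).2 _ (hC n)) i h

/-- At most one of the players has a winning strategy. -/
theorem RobberWins.not_copsWin (h : RobberWins G k c) : ¬ CopsWin G k c := by
  classical
  rintro ⟨S, hS⟩
  obtain ⟨T, hT⟩ := h
  -- The two strategies play against each other. The robber's `n`-th position depends on the cops'
  -- configurations up to `n`, and these only on the robber's positions before `n`.
  let R : ℕ → V := Nat.lt_wfRel.wf.fix fun n R =>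
    T n fun j => S j fun i => R i (lt_of_lt_of_le i.2 (Nat.lt_succ_iff.1 j.2))
  let C : ℕ → Fin c → V := fun n => S n fun j => R j
  have hR : ∀ n, R n = T n fun j => C j := fun n =>
    Nat.lt_wfRel.wf.fix_eq _ n
  -- Each strategy promises legal turns only against an opponent who is legal forever. So the
  -- opponent's play is frozen at the last time known to be legal; up to there the strategy sees the
  -- same history. Legality then spreads by alternating `cop` and `rob`.
  have cop : ∀ n, (∀ m < n, RobberStep G (R m) (R (m + 1))) → ∀ m ≤ n,
      CopStep G k (C m) (C (m + 1)) := by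
    intro n hn m hm
    have h1 := (hS (fun j => R (min j n)) fun j => by
      rcases lt_or_ge j n with hj | hj
      · rw [min_eq_left hj.le, min_eq_left (Nat.succ_le_of_lt hj)]
        exact hn j hj
      · rw [min_eq_right hj, min_eq_right (hj.trans (Nat.le_succ j))]
        exact Or.inl rfl).1 m
    have e : ∀ l ≤ n + 1, (fun j : Fin l => R (min j n)) = fun j : Fin l => R j := fun l hl =>
      funext fun j => congrArg R (min_eq_left (by omega))
    simpa only [e m (by omega), e (m + 1) (by omega)] using h1
  have rob : ∀ n, ∀ m < n, RobberStep G (R m) (R (m + 1)) := by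
    intro n
    induction n with
    | zero => simp
    | succ n ih =>
      intro m hm
      have h1 := (hT (fun j => C (min j (n + 1))) fun j => by
        rcases lt_or_ge j (n + 1) with hj | hj
        · rw [min_eq_left hj.le, min_eq_left (Nat.succ_le_of_lt hj)]
          exact cop n ih j (Nat.lt_succ_iff.1 hj)
        · rw [min_eq_right hj, min_eq_right (hj.trans (Nat.le_succ j))]
          exact CopStep.refl _).1 m
      have e : ∀ l ≤ n + 2, (fun j : Fin l => C (min j (n + 1))) = fun j : Fin l => C j :=
        fun l hl => funext fun j => congrArg C (min_eq_left (by omega))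
      simpa only [e (m + 1) (by omega), e (m + 1 + 1) (by omega), ← hR] using h1
  have rob' : ∀ n, RobberStep G (R n) (R (n + 1)) := fun n => rob (n + 1) n (Nat.lt_succ_self n)
  have h1 := (hS R rob').2
  refine (hT C fun n => cop n (rob n) n le_rfl).2 ?_
  simpa only [← hR] using h1

/-- Removing cops does not hurt the robber. -/
theorem RobberWins.mono {c' : ℕ} (h : RobberWins G k c) (hc : c' ≤ c) (v : V) :
    RobberWins G k c' := by
  obtain ⟨T, hT⟩ := h
  -- The surplus cops are parked at `v` and never move, so the number of moving cops is unchanged.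
  let ext : (Fin c' → V) → Fin c → V := fun C i => if h : i.1 < c' then C ⟨i, h⟩ else v
  have hext : ∀ C i, ext C (Fin.castLE hc i) = C i := fun C i => by simp [ext]
  refine ⟨fun n C => T n fun j => ext (C j), fun C hC => ?_⟩
  obtain ⟨h1, h2⟩ := hT (fun n => ext (C n)) fun n => by
    refine ⟨fun i => ?_, le_trans ?_ (hC n).2⟩
    · by_cases h : i.1 < c'
      · simpa [ext, h] using (hC n).1 ⟨i, h⟩
      · simp [ext, h]
    · refine (Set.ncard_le_ncard ?_ (Set.toFinite _)).trans
        (Set.ncard_image_le (f := Fin.castLE hc) (Set.toFinite _))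
      intro i hi
      by_cases h : i.1 < c'
      · exact ⟨⟨i, h⟩, by simpa [ext, h] using hi, rfl⟩
      · simp [ext, h] at hi
  refine ⟨h1, ?_⟩
  rintro ⟨n, i, h⟩
  exact h2 ⟨n, Fin.castLE hc i, by simpa only [hext] using h⟩

theorem RobberWins.lt_copNumber (h : RobberWins G k c) (v : V) : c < copNumber G k := by
  have : ((c + 1 : ℕ) : ℕ∞) ≤ copNumber G k := by
    refine le_iInf₂ fun c' hc' => ?_
    by_contra hlt
    have hlt : c' ≤ c := by
      have := lt_of_not_ge hlt
      exact Nat.lt_succ_iff.1 (by exact_mod_cast this)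
    exact (h.mono hlt v).not_copsWin hc'
  refine lt_of_lt_of_le ?_ this
  exact_mod_cast Nat.lt_succ_self c

end CopsRobber

namespace Soccer

/-! ### A numerical model of the graph -/

/-- The twelve orbits of vertices under the rotations of the icosahedron. -/
inductive Kind : Type
  | key | pentNext | pentPrev | hexNext | hexPrev | hexSymmL | hexSymmR
  | pentMid | hexMid | symmMid | spoke | center

/-- The neighbours of the vertex of a given kind at the dart `d`, in terms of the rotation `nxt`, its
inverse `prv` and the reversal `sym` of darts. -/
def nbrs {D β : Type*} (nxt prv sym : D → D) (mk : Kind → D → β) : Kind → D → List β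
  | .key, d => [mk .pentNext d, mk .pentPrev d, mk .hexNext d, mk .hexPrev d, mk .hexSymmL d,
      mk .hexSymmR d]
  | .pentNext, d => [mk .key d, mk .pentPrev d, mk .pentMid d]
  | .pentPrev, d => [mk .key d, mk .pentNext d, mk .pentMid (prv d)]
  | .hexNext, d => [mk .key d, mk .hexSymmL d, mk .hexMid d]
  | .hexPrev, d => [mk .key d, mk .hexSymmR d, mk .hexMid (prv d)]
  | .hexSymmL, d => [mk .key d, mk .hexNext d, mk .symmMid d]
  | .hexSymmR, d => [mk .key d, mk .hexPrev d, mk .symmMid (sym d)]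
  | .pentMid, d => [mk .pentNext d, mk .pentPrev (nxt d), mk .hexMid d]
  | .hexMid, d => [mk .hexNext d, mk .hexPrev (nxt d), mk .pentMid d, mk .spoke d]
  | .symmMid, d => [mk .hexSymmL d, mk .hexSymmR (sym d), mk .symmMid (sym d)]
  | .spoke, d => [mk .hexMid d, mk .center d]
  | .center, d => [mk .spoke d, mk .center (sym (nxt d)), mk .center (prv (sym d))]

def Kind.index : Kind → ℕ
  | .key => 0 | .pentNext => 1 | .pentPrev => 2 | .hexNext => 3 | .hexPrev => 4 | .hexSymmL => 5
  | .hexSymmR => 6 | .pentMid => 7 | .hexMid => 8 | .symmMid => 9 | .spoke => 10 | .center => 11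

def kindOf : ℕ → Kind
  | 0 => .key | 1 => .pentNext | 2 => .pentPrev | 3 => .hexNext | 4 => .hexPrev | 5 => .hexSymmL
  | 6 => .hexSymmR | 7 => .pentMid | 8 => .hexMid | 9 => .symmMid | 10 => .spoke | _ => .center

/-- The dart `5 * i + r` is the `r`-th dart around the vertex `i` of the icosahedron. -/
def nxtN (d : ℕ) : ℕ := bif Nat.beq (Nat.mod d 5) 4 then Nat.sub d 4 else Nat.succ d

def prvN (d : ℕ) : ℕ := bif Nat.beq (Nat.mod d 5) 0 then Nat.add d 4 else Nat.pred d

/-- The `d`-th digit in base 64. -/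
def digit (table d : ℕ) : ℕ := Nat.mod (Nat.shiftRight table (Nat.mul 6 d)) 64

/-- The constant packs the sixty values, six bits each; `sndOf_symN` verifies that they reverse
darts. -/
def symN (d : ℕ) : ℕ :=
  digit 0x8e8b727ae5db8b8a525b6e64351c7a7c832cef37079f71a1d1811ad6f4c3570a8e090ae52412e681d01950f285 d

/-- As `key` has index `0`, the key vertices are exactly the numbers below `60`. -/
def mkN (k : Kind) (d : ℕ) : ℕ := Nat.add (Nat.mul 60 k.index) d

/-- Function application with the argument evaluated first. -/
noncomputable def withNat {α : Sort*} (n : ℕ) (k : ℕ → α) : α :=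
  Nat.rec (k 0) (fun m _ => k (Nat.succ m)) n

/-- The neighbours of the vertex with number `n`. -/
noncomputable def nb (n : ℕ) : List ℕ :=
  withNat (Nat.mod n 60) fun d => nbrs nxtN prvN symN mkN (kindOf (Nat.div n 60)) d

/-! ### Evaluation of plans, with sets of vertices coded as bit masks -/

/-- The set with the elements of a list added to it. -/
noncomputable def insertAll (S : ℕ) (l : List ℕ) : ℕ :=
  List.rec S (fun k _ m => Nat.lor m (Nat.shiftLeft 1 k)) l

/-- The closed neighbourhood of a vertex. -/
noncomputable def nbMask (n : ℕ) : ℕ := insertAll (Nat.shiftLeft 1 n) (nb n)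

def full : ℕ := Nat.pred (Nat.shiftLeft 1 720)

/-- Add to `acc` the closed neighbourhood of the set of all `o + i` with `i < 2 ^ k` in `S`. -/
noncomputable def growAux (k : ℕ) : ℕ → ℕ → ℕ → ℕ :=
  Nat.rec (fun o S acc => bif Nat.beq S 0 then acc else Nat.lor acc (nbMask o))
    (fun k rec o S acc =>
      bif Nat.beq S 0 then acc
      else
        withNat (Nat.pow 2 k) fun w =>
        withNat (Nat.mod S (Nat.pow 2 w)) fun lo =>
        withNat (Nat.shiftRight S w) fun hi =>
        withNat (Nat.add o w) fun o' =>
        withNat (rec o lo acc) fun acc' => rec o' hi acc') k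

/-- The closed neighbourhood of a set. -/
noncomputable def grow (S : ℕ) : ℕ := withNat S fun S => growAux 10 0 S 0

/-- The positions from which a cop may disturb a robber who is about to run along a path. -/
noncomputable def pathMask (p : List ℕ) : ℕ :=
  List.rec 0 (fun y _ S => Nat.lor (nbMask y) (grow S)) p

def diff (S T : ℕ) : ℕ := Nat.xor S (Nat.land S T)

/-- A plan for the robber: a list of possible moves, each with safe routes from the new position to a
key vertex (paths, or the masks of paths) and a plan for the case that all these are blocked. -/
inductive Plan (α : Type) : Type
  | nil
  | node (y : ℕ) (routes : List α) (child sibling : Plan α)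

/-- The list `p` leads from `x` along edges to a key vertex, in at least one step. -/
noncomputable def isRoute (x : ℕ) : List ℕ → Bool
  | [] => false
  | [y] => (nb x).elem y && y.blt 60
  | y :: z :: p => (nb x).elem y && isRoute y (z :: p)

/-- The moves and routes of a plan for a robber at `x` follow the edges of the graph. -/
noncomputable def Plan.isValid (x : ℕ) : Plan (List ℕ) → Bool
  | .nil => true
  | .node y l c s => (nb x).elem y && l.all (isRoute y) && c.isValid y && s.isValid x

noncomputable def withMasks {α : Type*} (l : List (List ℕ)) : (List ℕ → α) → α :=
  List.rec (fun k => k []) (fun p _ rec k => withNat (pathMask p) fun m => rec fun l => k (m :: l)) l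

/-- Replace the paths of a plan by their masks. -/
noncomputable def Plan.withMasks {α : Type*} (c : Plan (List ℕ)) : (Plan ℕ → α) → α :=
  Plan.rec (fun k => k .nil) (fun y l _ _ child sibling k =>
    withNat y fun y => Soccer.withMasks l fun l => child fun c => sibling fun s =>
      k (.node y l c s)) c

/-- The members of `S` that, together with the set `cc`, block all routes. -/
noncomputable def blocked (cc : ℕ) (l : List ℕ) : ℕ → ℕ :=
  List.rec (fun S => S) (fun m _ rec S =>
    bif Nat.beq (Nat.land m cc) 0 then withNat (Nat.land S m) rec else rec S) l

def pair (a b : ℕ) : ℕ := Nat.lor (Nat.shiftLeft 1 a) (Nat.shiftLeft 1 b)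

/-- Remove from `T` what is returned by `f`, for all arguments in the list. -/
noncomputable def sweep (f : ℕ → ℕ → ℕ) (l : List ℕ) : ℕ → ℕ :=
  List.rec (fun T => T) (fun a _ rec T =>
    bif Nat.beq T 0 then 0
    else withNat a fun a => withNat (diff T (f a T)) rec) l

/-- The positions in `S` of the third cop for which the plan may fail when the other cops are at `a`
and `b`. -/
noncomputable def Plan.search (c : Plan ℕ) : ℕ → ℕ → ℕ → ℕ :=
  Plan.rec (fun _ _ S => S) (fun y l _ _ child sibling a b S =>
    bif Nat.beq S 0 then 0
    else
      withNat (nbMask y) fun N =>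
      bif Nat.beq (Nat.land N (pair a b)) 0 then
        withNat (diff S N) fun T =>
        withNat (sweep (fun a' T => withNat (blocked (pair a' b) l T) (child a' b)) (nb a) T) fun T =>
        withNat (sweep (fun b' T => withNat (blocked (pair a b') l T) (child a b')) (nb b) T) fun T =>
        withNat (grow T) fun U =>
        withNat (blocked (pair a b) l U) fun B =>
        withNat (child a b B) fun B =>
        withNat (grow B) fun B' =>
        withNat (diff S (diff T B')) fun S' => sibling a b S'
      else sibling a b S) c

/-- The check for the second cop at `b`, with the third cop in `far`. -/
noncomputable def rootCheck (far : ℕ) (l : List ℕ) (c : Plan ℕ) (a hard b : ℕ) : Bool :=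
  bif Nat.testBit far b then
    withNat (bif Nat.testBit hard b then far
      else diff (diff far hard) (Nat.pred (Nat.shiftLeft 1 b))) fun S =>
    withNat (blocked (pair a b) l S) fun S => Nat.beq (c.search a b S) 0
  else true

noncomputable def allBelow (f : ℕ → Bool) (n : ℕ) : Bool :=
  Nat.rec true (fun n ih => withNat n f && ih) n

/-- The plan works for a first cop at `a` and all positions below `n` of the others in `far`; the
positions in `hard` are those where a second cop may be hard to deal with. -/
noncomputable def Plan.worksBelow (n far : ℕ) (l : List (List ℕ)) (c : Plan (List ℕ))
    (a hard : ℕ) : Bool :=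
  l.all (isRoute 0) && c.isValid 0 &&
    Soccer.withMasks l fun l => c.withMasks fun c => withNat far fun far =>
      allBelow (fun b => rootCheck far l c a hard b) n

/-- The vertices at distance at least two from the vertex `0`. -/
noncomputable def far : ℕ := diff full (nbMask 0)

/-- The plan works for a first cop at `a` and all positions of the others in `far`. -/
noncomputable def Plan.works (l : List (List ℕ)) (c : Plan (List ℕ)) (a hard : ℕ) : Bool :=
  Plan.worksBelow 720 far l c a hard

/-! The first cop on the vertex `60`. -/

/-- Certificates for the kernel check: routes that the robber can start at once from `0`, then the
plan used when all of them are blocked. A route `[0]` inside a plan is a return to the starting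
vertex. The six cases come in three mirror pairs, exchanging `60` with `120`, `180` with `240` and
`300` with `360`. -/
def pentNextRoutes : List (List ℕ) :=
  [[240, 484, 604, 664, 689, 629, 509, 209, 29], [360, 545, 305, 185, 485, 246, 6], [240, 484,
    184, 304, 544, 385, 25], [300, 540, 365, 5]]

def pentNextPlan : Plan (List ℕ) :=
  .node 180 [[480, 241, 361, 550, 310, 10], [300, 540, 365, 5], [0]] (.node 480 [[241, 1]]
    (.node 241 [[361, 550, 310, 10], [1]] .nil .nil) .nil) (.node 240 [[484, 184, 4]] (.node 484
    [[184, 304, 544, 385, 25], [184, 4]] (.node 184 [[304, 544, 385, 25], [4]] .nil .nil) .nil)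
    .nil)

noncomputable def pentNextHard : ℕ := insertAll 0
  [6, 246, 366, 485, 605, 665]

theorem pentNext_works : Plan.works pentNextRoutes pentNextPlan 60 pentNextHard = true := by
  decide +kernel

/-! The first cop on the vertex `120`. -/

def pentPrevRoutes : List (List ℕ) :=
  [[180, 480, 600, 660, 670, 610, 490, 251, 11], [300, 540, 365, 245, 489, 189, 9], [180, 480,
    241, 361, 550, 310, 10], [360, 545, 305, 5]]

def pentPrevPlan : Plan (List ℕ) :=
  .node 240 [[484, 184, 304, 544, 385, 25], [360, 545, 305, 5], [0]] (.node 484 [[184, 4]]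
    (.node 184 [[304, 544, 385, 25], [4]] .nil .nil) .nil) (.node 180 [[480, 241, 1]] (.node 480
    [[241, 361, 550, 310, 10], [241, 1]] (.node 241 [[361, 550, 310, 10], [1]] .nil .nil) .nil)
    .nil)

noncomputable def pentPrevHard : ℕ := insertAll 0
  [9, 189, 309, 489, 609, 669]

theorem pentPrev_works : Plan.works pentPrevRoutes pentPrevPlan 120 pentPrevHard = true := by
  decide +kernel

/-! The first cop on the vertex `180`. -/

def hexNextRoutes : List (List ℕ) :=
  [[240, 484, 604, 664, 689, 629, 509, 209, 29], [360, 545, 305, 185, 485, 246, 6], [240, 484,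
    184, 304, 544, 385, 25], [120, 424, 64, 4]]

def hexNextPlan : Plan (List ℕ) :=
  .node 360 [[545, 305, 185, 485, 246, 6], [545, 305, 5]] (.node 545 [[305, 5]] (.node 305
    [[185, 485, 246, 6], [5]] .nil .nil) .nil) (.node 60 [[420, 121, 61, 421, 122, 2], [120,
    424, 64, 4], [420, 121, 1], [0]] (.node 420 [[121, 1]] (.node 121 [[61, 421, 122, 2], [1]]
    (.node 61 [[421, 481, 601, 661, 675, 615, 495, 256, 16], [421, 122, 2]] (.node 421 [[122,
    2]] (.node 481 [[601, 661, 674, 614, 494, 194, 14], [601, 661, 675, 615, 495, 256, 16]] .nil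
    .nil) .nil) .nil) .nil) .nil) .nil)

noncomputable def hexNextHard : ℕ := insertAll 0
  [25, 265, 385, 484, 604, 664]

theorem hexNext_works : Plan.works hexNextRoutes hexNextPlan 180 hexNextHard = true := by
  decide +kernel

/-! The first cop on the vertex `240`. -/

def hexPrevRoutes : List (List ℕ) :=
  [[180, 480, 600, 660, 670, 610, 490, 251, 11], [300, 540, 365, 245, 489, 189, 9], [180, 480,
    241, 361, 550, 310, 10], [60, 420, 121, 1]]

def hexPrevPlan : Plan (List ℕ) :=
  .node 300 [[540, 365, 245, 489, 189, 9], [540, 365, 5]] (.node 540 [[365, 5]] (.node 365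
    [[245, 489, 189, 9], [5]] .nil .nil) .nil) (.node 120 [[424, 64, 124, 423, 63, 3], [60, 420,
    121, 1], [424, 64, 4], [0]] (.node 424 [[64, 4]] (.node 64 [[124, 423, 63, 3], [4]] (.node
    124 [[423, 483, 603, 663, 684, 624, 504, 204, 24], [423, 63, 3]] (.node 423 [[63, 3]] (.node
    483 [[603, 663, 685, 625, 505, 266, 26], [603, 663, 684, 624, 504, 204, 24]] .nil .nil)
    .nil) .nil) .nil) .nil) .nil)

noncomputable def hexPrevHard : ℕ := insertAll 0
  [10, 190, 310, 480, 600, 660]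

theorem hexPrev_works : Plan.works hexPrevRoutes hexPrevPlan 240 hexPrevHard = true := by
  decide +kernel

/-! The first cop on the vertex `300`. -/

def hexSymmLRoutes : List (List ℕ) :=
  [[60, 420, 121, 61, 421, 122, 2], [120, 424, 64, 4]]

def hexSymmLPlan : Plan (List ℕ) :=
  .node 360 [[545, 305, 185, 485, 246, 6], [240, 484, 184, 4], [545, 305, 5], [0]] (.node 545
    [[305, 5]] (.node 305 [[185, 485, 246, 6], [5]] .nil .nil) .nil) (.node 60 [[420, 121, 61,
    421, 122, 2], [420, 121, 1]] (.node 420 [[121, 1]] (.node 121 [[1]] (.node 61 [[421, 481,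
    601, 661, 675, 615, 495, 256, 16], [421, 122, 2]] (.node 421 [[122, 2]] (.node 481 [[601,
    661, 674, 614, 494, 194, 14], [601, 661, 675, 615, 495, 256, 16]] .nil .nil) .nil) .nil)
    .nil) .nil) .nil)

noncomputable def hexSymmLHard : ℕ := insertAll 0
  [3, 4, 63, 64, 123, 124, 183, 244, 303, 423, 483, 603]

theorem hexSymmL_works : Plan.works hexSymmLRoutes hexSymmLPlan 300 hexSymmLHard = true := by
  decide +kernel

/-! The first cop on the vertex `360`. -/

def hexSymmRRoutes : List (List ℕ) :=
  [[120, 424, 64, 124, 423, 63, 3], [60, 420, 121, 1]]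

def hexSymmRPlan : Plan (List ℕ) :=
  .node 300 [[540, 365, 245, 489, 189, 9], [180, 480, 241, 1], [540, 365, 5], [0]] (.node 540
    [[365, 5]] (.node 365 [[245, 489, 189, 9], [5]] .nil .nil) .nil) (.node 120 [[424, 64, 124,
    423, 63, 3], [424, 64, 4]] (.node 424 [[64, 4]] (.node 64 [[4]] (.node 124 [[423, 483, 603,
    663, 684, 624, 504, 204, 24], [423, 63, 3]] (.node 423 [[63, 3]] (.node 483 [[603, 663, 685,
    625, 505, 266, 26], [603, 663, 684, 624, 504, 204, 24]] .nil .nil) .nil) .nil) .nil) .nil)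
    .nil)

noncomputable def hexSymmRHard : ℕ := insertAll 0
  [1, 2, 61, 62, 121, 122, 181, 242, 362, 421, 481, 601]

theorem hexSymmR_works : Plan.works hexSymmRRoutes hexSymmRPlan 360 hexSymmRHard = true := by
  decide +kernel

end Soccer

/-! ### Escaping positions, and the interchangeability of the cops -/

namespace Soccer

/-- In the game on `α` with closed neighbourhoods `N` and three cops, the robber, who is to move from
`x`, can reach a position at a key vertex that is adjacent to at most one cop. -/
inductive Escapes {α : Type*} (N : α → α → Prop) (key : α → Prop) : α → α → α → α → Prop
  | arrived {x a b c : α} : key x → a ≠ x → b ≠ x → c ≠ x → ¬ (N x a ∧ N x b) → ¬ (N x a ∧ N x c) →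
      ¬ (N x b ∧ N x c) → Escapes N key x a b c
  | move {x a b c : α} (y : α) : a ≠ x → b ≠ x → c ≠ x → N x y → a ≠ y → b ≠ y → c ≠ y →
      (∀ a', N a a' → Escapes N key y a' b c) → (∀ b', N b b' → Escapes N key y a b' c) →
      (∀ c', N c c' → Escapes N key y a b c') → Escapes N key x a b c

/-- The robber can make a move after which he still escapes. -/
def Advances {α : Type*} (N : α → α → Prop) (key : α → Prop) (x a b c : α) : Prop :=
  ∃ y, N x y ∧ a ≠ y ∧ b ≠ y ∧ c ≠ y ∧
    (∀ a', N a a' → Escapes N key y a' b c) ∧ (∀ b', N b b' → Escapes N key y a b' c) ∧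
      (∀ c', N c c' → Escapes N key y a b c')

section

variable {α : Type*} {N : α → α → Prop} {key : α → Prop} {x a b c : α}

theorem Advances.escapes (h : Advances N key x a b c) (ha : a ≠ x) (hb : b ≠ x) (hc : c ≠ x) :
    Escapes N key x a b c := by
  obtain ⟨y, h1, h2, h3, h4, h5, h6, h7⟩ := h
  exact .move y ha hb hc h1 h2 h3 h4 h5 h6 h7

theorem Escapes.swap (h : Escapes N key x a b c) : Escapes N key x b a c := by
  induction h with
  | arrived h1 h2 h3 h4 h5 h6 h7 => exact .arrived h1 h3 h2 h4 (fun h => h5 h.symm) h7 h6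
  | move y h1 h2 h3 h4 h5 h6 h7 _ _ _ i1 i2 i3 => exact .move y h2 h1 h3 h4 h6 h5 h7 i2 i1 i3

theorem Escapes.swap' (h : Escapes N key x a b c) : Escapes N key x a c b := by
  induction h with
  | arrived h1 h2 h3 h4 h5 h6 h7 => exact .arrived h1 h2 h4 h3 h6 h5 (fun h => h7 h.symm)
  | move y h1 h2 h3 h4 h5 h6 h7 _ _ _ i1 i2 i3 => exact .move y h1 h3 h2 h4 h5 h7 h6 i1 i3 i2

theorem Advances.swap (h : Advances N key x a b c) : Advances N key x b a c := by
  obtain ⟨y, h1, h2, h3, h4, h5, h6, h7⟩ := h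
  exact ⟨y, h1, h3, h2, h4, fun b' h => (h6 b' h).swap, fun a' h => (h5 a' h).swap,
    fun c' h => (h7 c' h).swap⟩

theorem Advances.swap' (h : Advances N key x a b c) : Advances N key x a c b := by
  obtain ⟨y, h1, h2, h3, h4, h5, h6, h7⟩ := h
  exact ⟨y, h1, h2, h4, h3, fun a' h => (h5 a' h).swap', fun c' h => (h7 c' h).swap',
    fun b' h => (h6 b' h).swap'⟩

end

/-! ### Soundness of the evaluation -/

@[simp] theorem withNat_eq {α : Sort*} (n : ℕ) (k : ℕ → α) : withNat n k = k n := by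
  cases n <;> rfl

@[simp] theorem testBit_insertAll (S : ℕ) (l : List ℕ) (i : ℕ) :
    (insertAll S l).testBit i = true ↔ S.testBit i = true ∨ i ∈ l := by
  induction l with
  | nil => simp [insertAll]
  | cons k l ih =>
    have : insertAll S (k :: l) = insertAll S l ||| (1 <<< k) := rfl
    rw [this, Nat.testBit_or, Bool.or_eq_true, ih, Nat.one_shiftLeft, Nat.testBit_two_pow]
    simp only [decide_eq_true_eq, List.mem_cons]
    tauto

/-- Closed neighbourhoods in the numerical model. -/
def Near (x y : ℕ) : Prop := y = x ∨ y ∈ nb x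

theorem Near.refl (x : ℕ) : Near x x := Or.inl rfl

/-- Symmetry is what allows neighbourhoods to be read backwards: a cop who can step into a set
stands in the closed neighbourhood of that set. -/
theorem nb_lt_and_symm : ∀ x < 720, ∀ y ∈ nb x, y < 720 ∧ x ∈ nb y := by decide +kernel

theorem Near.lt {x y : ℕ} (h : Near x y) (hx : x < 720) : y < 720 :=
  h.elim (fun h => h ▸ hx) fun h => (nb_lt_and_symm x hx y h).1

theorem Near.symm {x y : ℕ} (h : Near x y) (hx : x < 720) : Near y x :=
  h.imp Eq.symm fun h => (nb_lt_and_symm x hx y h).2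

@[simp] theorem testBit_nbMask (x y : ℕ) : (nbMask x).testBit y = true ↔ Near x y := by
  have : Nat.shiftLeft 1 x = 2 ^ x := Nat.one_shiftLeft x
  rw [nbMask, testBit_insertAll, this, Nat.testBit_two_pow, Near, decide_eq_true_eq]
  exact or_congr_left eq_comm

theorem beq_zero_of_pos {n : ℕ} (h : 0 < n) : Nat.beq n 0 = false := by
  cases n
  · exact (lt_irrefl 0 h).elim
  · rfl

theorem growAux_succ (k o S acc : ℕ) : growAux (k + 1) o S acc = bif Nat.beq S 0 then acc else
    growAux k (o + 2 ^ k) (S >>> 2 ^ k) (growAux k o (S % 2 ^ 2 ^ k) acc) := by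
  have e : growAux (k + 1) o S acc = bif Nat.beq S 0 then acc else
      withNat (Nat.pow 2 k) fun w =>
      withNat (Nat.mod S (Nat.pow 2 w)) fun lo =>
      withNat (Nat.shiftRight S w) fun hi =>
      withNat (Nat.add o w) fun o' =>
      withNat (growAux k o lo acc) fun acc' => growAux k o' hi acc' := rfl
  rw [e]
  simp only [withNat_eq]
  rfl

/-- Only one inclusion is needed: a closed neighbourhood computed too large would make the check
more pessimistic, never unsound. -/
theorem testBit_growAux (k o S acc j : ℕ) :
    (acc.testBit j = true → (growAux k o S acc).testBit j = true) ∧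
      ∀ i < 2 ^ k, S.testBit i = true → Near (o + i) j →
        (growAux k o S acc).testBit j = true := by
  induction k generalizing o S acc with
  | zero =>
    have e : growAux 0 o S acc = bif Nat.beq S 0 then acc else acc ||| nbMask o := rfl
    rw [e]
    rcases Nat.eq_zero_or_pos S with rfl | hS
    · simp
    · have : Nat.beq S 0 = false := beq_zero_of_pos hS
      simp only [this, cond_false, Nat.testBit_or, Bool.or_eq_true, testBit_nbMask]
      refine ⟨Or.inl, fun i hi _ h => Or.inr ?_⟩
      obtain rfl : i = 0 := by omega
      exact h
  | succ k ih =>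
    rw [growAux_succ]
    rcases Nat.eq_zero_or_pos S with rfl | hS
    · simp
    · have : Nat.beq S 0 = false := beq_zero_of_pos hS
      simp only [this, cond_false]
      refine ⟨fun h => (ih ..).1 ((ih ..).1 h), fun i hi hS h => ?_⟩
      rcases lt_or_ge i (2 ^ k) with hik | hik
      · exact (ih ..).1 ((ih ..).2 i hik (by rw [Nat.testBit_mod_two_pow]; simp [hik, hS]) h)
      · refine (ih ..).2 (i - 2 ^ k) (by rw [pow_succ] at hi; omega) ?_ ?_
        · rw [Nat.testBit_shiftRight]
          rwa [Nat.add_sub_cancel' hik]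
        · rwa [add_assoc, Nat.add_sub_cancel' hik]

theorem testBit_grow {S i j : ℕ} (hi : i < 720) (hS : S.testBit i = true) (h : Near i j) :
    (grow S).testBit j = true := by
  rw [grow, withNat_eq]
  exact (testBit_growAux 10 0 S 0 j).2 i (by omega) hS (by rwa [Nat.zero_add])

@[simp] theorem testBit_diff (S T i : ℕ) :
    (diff S T).testBit i = true ↔ S.testBit i = true ∧ ¬ T.testBit i = true := by
  have : diff S T = S ^^^ (S &&& T) := rfl
  rw [this, Nat.testBit_xor, Nat.testBit_and]
  cases S.testBit i <;> cases T.testBit i <;> simp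

theorem land_pair {m a b : ℕ} (h : Nat.beq (Nat.land m (pair a b)) 0 = true) :
    ¬ m.testBit a = true ∧ ¬ m.testBit b = true := by
  have h0 : m &&& (2 ^ a ||| 2 ^ b) = 0 := by
    rw [← Nat.one_shiftLeft, ← Nat.one_shiftLeft]
    exact Nat.eq_of_beq_eq_true h
  constructor <;> intro h1
  · have := congrArg (fun n => n.testBit a) h0
    simp [h1] at this
  · have := congrArg (fun n => n.testBit b) h0
    simp [h1] at this

/-- The cops outside the set `m` cannot stop a robber who is to move from `x`. -/
def Clears (x m : ℕ) : Prop :=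
  ∀ a < 720, ∀ b < 720, ∀ c < 720, ¬ m.testBit a = true → ¬ m.testBit b = true →
    ¬ m.testBit c = true → Advances Near (· < 60) x a b c

theorem Near.ne {y a a' : ℕ} (hy : ¬ Near y a) (ha : a < 720) (h : Near a a') : a' ≠ y := by
  rintro rfl
  exact hy (h.symm ha)

/-- The mask consists of the positions within distance `i` of the `i`-th vertex of the path, for
some `i ≥ 1`. When the robber is about to step on that vertex, every cop has had at most `i - 1`
moves, so a cop who started outside the mask is still not in its closed neighbourhood. -/
theorem clears_pathMask {x : ℕ} {p : List ℕ} (h : isRoute x p = true) : Clears x (pathMask p) := by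
  induction p generalizing x with
  | nil => simp [isRoute] at h
  | cons y p ih =>
    intro a ha b hb c hc
    have e : pathMask (y :: p) = nbMask y ||| grow (pathMask p) := rfl
    simp only [e, Nat.testBit_or, Bool.or_eq_true, testBit_nbMask, not_or, and_imp]
    intro a1 a2 b1 b2 c1 c2
    have hxy : Near x y := by
      cases p <;> simp only [isRoute, Bool.and_eq_true, List.elem_iff] at h <;> exact Or.inr h.1
    have ay := Near.ne a1 ha (.refl a)
    have byy := Near.ne b1 hb (.refl b)
    have cy := Near.ne c1 hc (.refl c)
    refine ⟨y, hxy, ay, byy, cy, ?_⟩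
    rcases p with _ | ⟨z, p⟩
    · have hy : y < 60 := by
        simp only [isRoute, Bool.and_eq_true, Nat.blt_eq] at h
        exact h.2
      -- At the end of the path no cop is near, and the one cop who then moves is the only one who
      -- can come near.
      exact ⟨fun a' h => .arrived hy (Near.ne a1 ha h) byy cy (by tauto) (by tauto) (by tauto),
        fun b' h => .arrived hy ay (Near.ne b1 hb h) cy (by tauto) (by tauto) (by tauto),
        fun c' h => .arrived hy ay byy (Near.ne c1 hc h) (by tauto) (by tauto) (by tauto)⟩
    · have hp : Clears y (pathMask (z :: p)) := ih (by
        simp only [isRoute, Bool.and_eq_true] at h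
        exact h.2)
      have key : ∀ {i j}, i < 720 → Near i j → ¬ (grow (pathMask (z :: p))).testBit i = true →
          ¬ (pathMask (z :: p)).testBit j = true :=
        fun hi hij h hj => h (testBit_grow (hij.lt hi) hj (hij.symm hi))
      have a3 := key ha (.refl a) a2
      have b3 := key hb (.refl b) b2
      have c3 := key hc (.refl c) c2
      exact ⟨fun a' h => (hp a' (h.lt ha) b hb c hc (key ha h a2) b3 c3).escapes
          (Near.ne a1 ha h) byy cy,
        fun b' h => (hp a ha b' (h.lt hb) c hc a3 (key hb h b2) c3).escapes
          ay (Near.ne b1 hb h) cy,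
        fun c' h => (hp a ha b hb c' (h.lt hc) a3 b3 (key hc h c2)).escapes
          ay byy (Near.ne c1 hc h)⟩

/-- `blocked` intersects `S` with just those masks that avoid `a` and `b`; a position lost on the
way lies outside one of them. -/
theorem exists_of_not_blocked {a b c : ℕ} {l : List ℕ} {S : ℕ} (hS : S.testBit c = true)
    (h : ¬ (blocked (pair a b) l S).testBit c = true) :
    ∃ m ∈ l, ¬ m.testBit a = true ∧ ¬ m.testBit b = true ∧ ¬ m.testBit c = true := by
  induction l generalizing S with
  | nil => exact (h hS).elim
  | cons m l ih =>
    have e : blocked (pair a b) (m :: l) S = bif Nat.beq (Nat.land m (pair a b)) 0 then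
        withNat (Nat.land S m) (blocked (pair a b) l) else blocked (pair a b) l S := rfl
    rw [e, withNat_eq] at h
    cases hm : Nat.beq (Nat.land m (pair a b)) 0
    · simp only [hm, cond_false] at h
      obtain ⟨m', h1, h2⟩ := ih hS h
      exact ⟨m', List.mem_cons_of_mem _ h1, h2⟩
    · simp only [hm, cond_true] at h
      by_cases hc : m.testBit c = true
      · obtain ⟨m', h1, h2⟩ := ih ((Nat.testBit_and ..).trans (by simp [hS, hc])) h
        exact ⟨m', List.mem_cons_of_mem _ h1, h2⟩
      · exact ⟨m, List.mem_cons_self, (land_pair hm).1, (land_pair hm).2, hc⟩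

/-- The set shrinks during the sweep, so `f a` is applied to a different set for each `a`. A
position that survives belonged to each of these sets and was not returned by `f a`. -/
theorem testBit_sweep {f : ℕ → ℕ → ℕ} {l : List ℕ} {T c : ℕ}
    (h : (sweep f l T).testBit c = true) :
    T.testBit c = true ∧ ∀ a ∈ l, ∃ T', T'.testBit c = true ∧ ¬ (f a T').testBit c = true := by
  induction l generalizing T with
  | nil => exact ⟨h, by simp⟩
  | cons a l ih =>
    have e : sweep f (a :: l) T = bif Nat.beq T 0 then 0 else
        withNat a fun a => withNat (diff T (f a T)) (sweep f l) := rfl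
    simp only [e, withNat_eq] at h
    cases hT : Nat.beq T 0
    · simp only [hT, cond_false] at h
      obtain ⟨h1, h2⟩ := ih h
      rw [testBit_diff] at h1
      refine ⟨h1.1, fun a' ha' => ?_⟩
      rcases List.mem_cons.1 ha' with rfl | ha'
      · exact ⟨T, h1⟩
      · exact h2 a' ha'
    · simp [hT] at h

/-- The moves of a plan are legal and the masks belong to safe routes. -/
def Plan.Sound (x : ℕ) : Plan ℕ → Prop
  | .nil => True
  | .node y l c s => (y < 720 ∧ Near x y ∧ ∀ m ∈ l, Clears y m) ∧ c.Sound y ∧ s.Sound x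

theorem Plan.search_node (y : ℕ) (l : List ℕ) (p s : Plan ℕ) (a b S : ℕ) :
    (Plan.node y l p s).search a b S = bif Nat.beq S 0 then 0 else
      bif Nat.beq (Nat.land (nbMask y) (pair a b)) 0 then
        let T := sweep (fun b' T => p.search a b' (blocked (pair a b') l T)) (nb b)
          (sweep (fun a' T => p.search a' b (blocked (pair a' b) l T)) (nb a)
            (diff S (nbMask y)))
        s.search a b (diff S (diff T (grow (p.search a b (blocked (pair a b) l (grow T))))))
      else s.search a b S := by
  have e : (Plan.node y l p s).search a b S = bif Nat.beq S 0 then 0 else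
      withNat (nbMask y) fun N =>
      bif Nat.beq (Nat.land N (pair a b)) 0 then
        withNat (diff S N) fun T =>
        withNat (sweep (fun a' T => withNat (blocked (pair a' b) l T) (p.search a' b)) (nb a) T)
          fun T =>
        withNat (sweep (fun b' T => withNat (blocked (pair a b') l T) (p.search a b')) (nb b) T)
          fun T =>
        withNat (grow T) fun U =>
        withNat (blocked (pair a b) l U) fun B =>
        withNat (p.search a b B) fun B =>
        withNat (grow B) fun B' =>
        withNat (diff S (diff T B')) fun S' => s.search a b S'
      else s.search a b S := rfl
  rw [e]
  simp only [withNat_eq]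

/-- Induction on the plan. The first two cops are fixed and their responses are tried one by one;
the third cop is treated as a set, with all responses given by a single `grow`. -/
theorem Plan.search_sound {p : Plan ℕ} {x a b c S : ℕ} (hp : p.Sound x) (ha : a < 720)
    (hb : b < 720) (hc : c < 720) (hS : S.testBit c = true)
    (h : ¬ (p.search a b S).testBit c = true) : Advances Near (· < 60) x a b c := by
  induction p generalizing x a b c S with
  | nil => exact (h hS).elim
  | node y l p s ihp ihs =>
    obtain ⟨⟨hy, hxy, hl⟩, hpy, hsx⟩ := hp
    rw [search_node] at h
    have hS0 : Nat.beq S 0 = false := beq_zero_of_pos (Nat.pos_of_ne_zero (by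
      rintro rfl
      simp at hS))
    simp only [hS0, cond_false] at h
    cases hN : Nat.beq (Nat.land (nbMask y) (pair a b)) 0
    · simp only [hN, cond_false] at h
      exact ihs hsx ha hb hc hS h
    simp only [hN, cond_true] at h
    set T := sweep (fun b' T => p.search a b' (blocked (pair a b') l T)) (nb b)
      (sweep (fun a' T => p.search a' b (blocked (pair a' b) l T)) (nb a) (diff S (nbMask y)))
      with hT
    -- Positions of the third cop settled by the move to `y` are removed from `S`; the others are
    -- left to the sibling.
    by_cases hcT : (diff T (grow (p.search a b (blocked (pair a b) l (grow T))))).testBit c = true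
    swap
    · exact ihs hsx ha hb hc ((testBit_diff ..).2 ⟨hS, hcT⟩) h
    obtain ⟨hcT, hcB⟩ := (testBit_diff ..).1 hcT
    have hcT' := hcT
    rw [hT] at hcT'
    obtain ⟨h1, h2⟩ := testBit_sweep hcT'
    obtain ⟨h1, h3⟩ := testBit_sweep h1
    have hay := mt (testBit_nbMask _ _).2 (land_pair hN).1
    have hby := mt (testBit_nbMask _ _).2 (land_pair hN).2
    have hcy := mt (testBit_nbMask _ _).2 ((testBit_diff ..).1 h1).2
    -- After any response, either some listed route is free or the child plan takes over.
    have key : ∀ {a b c T}, a < 720 → b < 720 → c < 720 → a ≠ y → b ≠ y → c ≠ y →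
        T.testBit c = true → ¬ (p.search a b (blocked (pair a b) l T)).testBit c = true →
        Escapes Near (· < 60) y a b c := by
      intro a b c T ha hb hc ha' hb' hc' h1 h2
      refine Advances.escapes ?_ ha' hb' hc'
      by_cases h3 : (blocked (pair a b) l T).testBit c = true
      · exact ihp hpy ha hb hc h3 h2
      · obtain ⟨m, hm, h4, h5, h6⟩ := exists_of_not_blocked h1 h3
        exact hl m hm a ha b hb c hc h4 h5 h6
    have ay := Near.ne hay ha (.refl a)
    have byy := Near.ne hby hb (.refl b)
    have cy := Near.ne hcy hc (.refl c)
    -- If the child failed at `c'`, then `c`, being near `c'`, would have been removed together with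
    -- the closed neighbourhood of the failures.
    have hcc : ∀ c', Near c c' → Escapes Near (· < 60) y a b c' := fun c' h =>
      key ha hb (h.lt hc) ay byy (Near.ne hcy hc h) (testBit_grow hc hcT h)
        fun h' => hcB (testBit_grow (h.lt hc) h' (h.symm hc))
    refine ⟨y, hxy, ay, byy, cy, ?_, ?_, hcc⟩
    -- The sweeps run only over proper moves of the first two cops. A turn without a move is already
    -- covered by the third cop staying.
    · rintro a' (rfl | h)
      · exact hcc c (.refl c)
      · obtain ⟨T', h4, h5⟩ := h3 a' h
        exact key ((nb_lt_and_symm a ha a' h).1) hb hc (Near.ne hay ha (Or.inr h)) byy cy h4 h5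
    · rintro b' (rfl | h)
      · exact hcc c (.refl c)
      · obtain ⟨T', h4, h5⟩ := h2 b' h
        exact key ha ((nb_lt_and_symm b hb b' h).1) hc ay (Near.ne hby hb (Or.inr h)) cy h4 h5

def Plan.map {α β : Type} (f : α → β) : Plan α → Plan β
  | .nil => .nil
  | .node y l c s => .node y (l.map f) (c.map f) (s.map f)

theorem withMasks_eq {α : Type*} (l : List (List ℕ)) (k : List ℕ → α) :
    withMasks l k = k (l.map pathMask) := by
  induction l generalizing k with
  | nil => rfl
  | cons p l ih =>
    change withNat (pathMask p) (fun m => withMasks l fun l => k (m :: l)) = _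
    rw [withNat_eq, ih]
    rfl

theorem Plan.withMasks_eq {α : Type*} (p : Plan (List ℕ)) (k : Plan ℕ → α) :
    p.withMasks k = k (p.map pathMask) := by
  induction p generalizing k with
  | nil => rfl
  | node y l c s ihc ihs =>
    change withNat y (fun y => Soccer.withMasks l fun l => c.withMasks fun c => s.withMasks fun s =>
      k (.node y l c s)) = _
    rw [withNat_eq, Soccer.withMasks_eq, ihc, ihs]
    rfl

theorem Plan.sound_of_isValid {p : Plan (List ℕ)} {x : ℕ} (hx : x < 720)
    (h : p.isValid x = true) : (p.map pathMask).Sound x := by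
  induction p generalizing x with
  | nil => trivial
  | node y l c s ihc ihs =>
    simp only [isValid, Bool.and_eq_true, List.elem_iff, List.all_eq_true] at h
    obtain ⟨⟨⟨h1, h2⟩, h3⟩, h4⟩ := h
    have hy := (nb_lt_and_symm x hx y h1).1
    refine ⟨⟨hy, Or.inr h1, ?_⟩, ihc hy h3, ihs hx h4⟩
    intro m hm
    obtain ⟨p, hp, rfl⟩ := List.mem_map.1 hm
    exact clears_pathMask (h2 p hp)

theorem of_allBelow {f : ℕ → Bool} {n : ℕ} (h : allBelow f n = true) : ∀ b < n, f b = true := by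
  induction n with
  | zero => simp
  | succ n ih =>
    have e : allBelow f (n + 1) = (withNat n f && allBelow f n) := rfl
    rw [e, withNat_eq, Bool.and_eq_true] at h
    intro b hb
    rcases Nat.lt_succ_iff_lt_or_eq.1 hb with hb | rfl
    · exact ih h.2 b hb
    · exact h.1

theorem testBit_pred_shiftLeft (n i : ℕ) :
    (Nat.pred (Nat.shiftLeft 1 n)).testBit i = decide (i < n) := by
  have : Nat.pred (Nat.shiftLeft 1 n) = 2 ^ n - 1 := congrArg Nat.pred (Nat.one_shiftLeft n)
  rw [this, Nat.testBit_two_pow_sub_one]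

theorem testBit_far {b : ℕ} (hb : b < 720) (h : ¬ Near 0 b) : far.testBit b = true := by
  have : full.testBit b = decide (b < 720) := testBit_pred_shiftLeft 720 b
  rw [far, testBit_diff, testBit_nbMask, this, decide_eq_true_eq]
  exact ⟨hb, h⟩

/-- The last two cops are interchangeable, so each unordered pair needs one check. A hard position
is enumerated as the second cop against all of `F`; for two positions that are not hard, the smaller
number is the second cop. -/
theorem Plan.advances_of_worksBelow {n F : ℕ} (hn : n ≤ 720) {l : List (List ℕ)}
    {p : Plan (List ℕ)} {a hard : ℕ} (h : Plan.worksBelow n F l p a hard = true) (ha : a < 720)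
    {b c : ℕ} (hb : b < n) (hc : c < n) (hb0 : F.testBit b = true) (hc0 : F.testBit c = true) :
    Advances Near (· < 60) 0 a b c := by
  simp only [worksBelow, withNat_eq, Soccer.withMasks_eq, Plan.withMasks_eq, Bool.and_eq_true,
    List.all_eq_true] at h
  obtain ⟨⟨hl, hp⟩, h⟩ := h
  have hps := sound_of_isValid (by norm_num) hp
  have key : ∀ b < n, ∀ c < n, F.testBit b = true → F.testBit c = true →
      (hard.testBit b = true ∨ ¬ hard.testBit c = true ∧ b ≤ c) →
      Advances Near (· < 60) 0 a b c := by
    intro b hb c hc hb0 hc0 hbc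
    have hr := of_allBelow h b hb
    simp only [rootCheck, hb0, cond_true, withNat_eq] at hr
    set S := bif hard.testBit b then F else diff (diff F hard) (Nat.pred (Nat.shiftLeft 1 b))
      with hS
    have hcS : S.testBit c = true := by
      cases hbh : hard.testBit b
      · have hbc := hbc.resolve_left (by simp [hbh])
        simp only [hS, hbh, cond_false, testBit_diff, testBit_pred_shiftLeft]
        exact ⟨⟨hc0, hbc.1⟩, by simpa using hbc.2⟩
      · simpa only [hS, hbh, cond_true] using hc0
    by_cases hcb : (blocked (pair a b) (l.map pathMask) S).testBit c = true
    · refine search_sound hps ha (hb.trans_le hn) (hc.trans_le hn) hcb ?_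
      rw [Nat.eq_of_beq_eq_true hr]
      simp
    · obtain ⟨m, hm, h1, h2, h3⟩ := exists_of_not_blocked hcS hcb
      obtain ⟨q, hq, rfl⟩ := List.mem_map.1 hm
      exact clears_pathMask (hl q hq) a ha b (hb.trans_le hn) c
        (hc.trans_le hn) h1 h2 h3
  by_cases h1 : hard.testBit b = true
  · exact key b hb c hc hb0 hc0 (Or.inl h1)
  by_cases h2 : hard.testBit c = true
  · exact (key c hc b hb hc0 hb0 (Or.inl h2)).swap'
  rcases le_total b c with h3 | h3
  · exact key b hb c hc hb0 hc0 (Or.inr ⟨h2, h3⟩)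
  · exact (key c hc b hb hc0 hb0 (Or.inr ⟨h1, h3⟩)).swap'

theorem Plan.advances_of_works {l : List (List ℕ)} {p : Plan (List ℕ)} {a hard : ℕ}
    (h : Plan.works l p a hard = true) (ha : a < 720) {b c : ℕ} (hb : b < 720) (hc : c < 720)
    (hb0 : ¬ Near 0 b) (hc0 : ¬ Near 0 c) : Advances Near (· < 60) 0 a b c :=
  advances_of_worksBelow le_rfl h ha hb hc (testBit_far hb hb0) (testBit_far hc hc0)

/-- The robber at the vertex `0` can run when he is threatened by a single cop. -/
theorem advances_of_near {a b c : ℕ} (ha : a ∈ nb 0) (hb : b < 720) (hc : c < 720)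
    (hb0 : ¬ Near 0 b) (hc0 : ¬ Near 0 c) : Advances Near (· < 60) 0 a b c := by
  have h : nb 0 = [60, 120, 180, 240, 300, 360] := by decide +kernel
  rw [h] at ha
  simp only [List.mem_cons, List.not_mem_nil, or_false] at ha
  rcases ha with rfl | rfl | rfl | rfl | rfl | rfl
  · exact Plan.advances_of_works pentNext_works (by norm_num) hb hc hb0 hc0
  · exact Plan.advances_of_works pentPrev_works (by norm_num) hb hc hb0 hc0
  · exact Plan.advances_of_works hexNext_works (by norm_num) hb hc hb0 hc0
  · exact Plan.advances_of_works hexPrev_works (by norm_num) hb hc hb0 hc0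
  · exact Plan.advances_of_works hexSymmL_works (by norm_num) hb hc hb0 hc0
  · exact Plan.advances_of_works hexSymmR_works (by norm_num) hb hc hb0 hc0

end Soccer

namespace Soccer

/-! ### Rotations of darts -/

/-- The neighbour of `i` that follows `j` in the cyclic order around `i`. -/
def turn : Ico → Ico → Ico
  | (true, none), (_, some i) => (true, some (i + 1))
  | (false, none), (_, some i) => (false, some (i - 1))
  | (true, some i), (_, none) => (true, some (i - 1))
  | (false, some i), (_, none) => (false, some (i + 1))
  | (true, some i), (true, some j) => if j = i - 1 then (false, some i) else (true, none)
  | (true, some i), (false, some j) =>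
    if j = i then (false, some (i + 1)) else (true, some (i + 1))
  | (false, some i), (false, some j) => if j = i + 1 then (true, some i) else (false, none)
  | (false, some i), (true, some j) =>
    if j = i then (true, some (i - 1)) else (false, some (i - 1))
  | i, _ => i

instance : DecidableRel icosahedron.Adj := fun x y => by
  unfold icosahedron
  rw [SimpleGraph.fromRel_adj]
  rcases x with ⟨_ | _, _ | i⟩ <;> rcases y with ⟨_ | _, _ | j⟩ <;> infer_instance

/-- The triangles on the two sides of the edge `ij` have third vertices `turn i j` and `turn j i`.
Hence, around `i`, the successor of `j` is `turn i j` and its predecessor is `turn j i`, which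
explains the inversion formulas. -/
theorem turn_spec : ∀ i j, icosahedron.Adj i j →
    icosahedron.Adj i (turn i j) ∧ icosahedron.Adj j (turn i j) ∧ turn i (turn j i) = j ∧
      turn (turn i j) i = j ∧ turn j (turn i j) = i ∧ turn i j ≠ turn j i ∧
        turn i (turn i j) ≠ j := by
  decide +kernel

theorem eq_turn : ∀ i j, icosahedron.Adj i j → ∀ k, icosahedron.Adj i k → icosahedron.Adj j k →
    k = turn i j ∨ k = turn j i := by
  decide +kernel

end Soccer

namespace Soccer

open SimpleGraph

/-- The dart that follows `d` in the cyclic order around its first vertex. -/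
def next (d : BVertex) : BVertex := ⟨(d.fst, turn d.fst d.snd), (turn_spec _ _ d.adj).1⟩

/-- The dart that precedes `d` in the cyclic order around its first vertex. -/
def prev (d : BVertex) : BVertex := ⟨(d.fst, turn d.snd d.fst), (turn_spec _ _ d.adj.symm).2.1⟩

theorem dart_ext {d e : BVertex} (h1 : d.fst = e.fst) (h2 : d.snd = e.snd) : d = e :=
  Dart.ext _ _ (Prod.ext h1 h2)

@[simp] theorem next_prev (d : BVertex) : next (prev d) = d :=
  dart_ext rfl (turn_spec _ _ d.adj).2.2.1

@[simp] theorem prev_next (d : BVertex) : prev (next d) = d :=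
  dart_ext rfl (turn_spec _ _ d.adj).2.2.2.1

theorem next_ne_prev (d : BVertex) : next d ≠ prev d := fun h =>
  (turn_spec _ _ d.adj).2.2.2.2.2.1 (congrArg (fun e : BVertex => e.snd) h)

theorem next_next_ne (d : BVertex) : next (next d) ≠ d := fun h =>
  (turn_spec _ _ d.adj).2.2.2.2.2.2 (congrArg (fun e : BVertex => e.snd) h)

theorem symm_fst_ne (d : BVertex) : d.symm.fst ≠ d.fst := d.adj.ne'

theorem next_ne_symm (d e : BVertex) (h : e.fst = d.fst) : next e ≠ d.symm := fun h' =>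
  symm_fst_ne d (by rw [← h']; exact h)

theorem prev_ne_symm (d : BVertex) : prev d ≠ d.symm := fun h =>
  symm_fst_ne d (by rw [← h]; rfl)

/-- The triangle to the left of a dart. -/
def tri (d : BVertex) : Triangle :=
  ⟨{d.fst, d.snd, turn d.fst d.snd}, is3Clique_triple_iff.2
    ⟨d.adj, (turn_spec _ _ d.adj).1, (turn_spec _ _ d.adj).2.1⟩⟩

theorem mem_tri {d : BVertex} {i : Ico} :
    i ∈ (tri d).1 ↔ i = d.fst ∨ i = d.snd ∨ i = turn d.fst d.snd := by
  simp [tri]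

theorem fst_mem_tri (d : BVertex) : d.fst ∈ (tri d).1 := mem_tri.2 (Or.inl rfl)

theorem snd_mem_tri (d : BVertex) : d.snd ∈ (tri d).1 := mem_tri.2 (Or.inr (Or.inl rfl))

theorem turn_mem_tri (d : BVertex) : turn d.fst d.snd ∈ (tri d).1 :=
  mem_tri.2 (Or.inr (Or.inr rfl))

theorem turn_not_mem_tri_symm (d : BVertex) : turn d.fst d.snd ∉ (tri d.symm).1 := fun h => by
  obtain ⟨h1, h2, -, -, -, h3, -⟩ := turn_spec _ _ d.adj
  rcases mem_tri.1 h with h | h | h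
  · exact h2.ne h.symm
  · exact h1.ne h.symm
  · exact h3 h

theorem tri_ne_tri_symm (d : BVertex) : tri d ≠ tri d.symm := fun h =>
  turn_not_mem_tri_symm d (h ▸ turn_mem_tri d)

theorem tri_prev (d : BVertex) : tri (prev d) = tri d.symm := by
  apply Subtype.ext
  ext i
  rw [mem_tri, mem_tri]
  change i = d.fst ∨ i = turn d.snd d.fst ∨ i = turn d.fst (turn d.snd d.fst) ↔
    i = d.snd ∨ i = d.fst ∨ i = turn d.snd d.fst
  rw [(turn_spec _ _ d.adj).2.2.1]
  tauto

theorem tri_symm_next (d : BVertex) : tri (next d).symm = tri d := by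
  rw [← tri_prev, prev_next]

theorem tri_prev_symm (d : BVertex) : tri (prev d.symm) = tri d := by
  rw [tri_prev, Dart.symm_symm]

/-- The third vertex of `t` is a common neighbour of the ends of `d`, and by `eq_turn` there are
only two of these. -/
theorem eq_tri_or_eq_tri_symm {t : Triangle} {d : BVertex} (h1 : d.fst ∈ t.1) (h2 : d.snd ∈ t.1) :
    t = tri d ∨ t = tri d.symm := by
  have hc := t.2.card_eq
  obtain ⟨k, hk, hk'⟩ : ∃ k ∈ t.1, k ∉ ({d.fst, d.snd} : Finset Ico) := by
    apply Finset.exists_mem_notMem_of_card_lt_card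
    rw [hc, Finset.card_pair d.adj.ne]
    norm_num
  simp only [Finset.mem_insert, Finset.mem_singleton, not_or] at hk'
  have hk1 := t.2.isClique h1 hk (Ne.symm hk'.1)
  have hk2 := t.2.isClique h2 hk (Ne.symm hk'.2)
  have key : ∀ t' : Triangle, d.fst ∈ t'.1 → d.snd ∈ t'.1 → k ∈ t'.1 → t = t' := by
    intro t' h1' h2' hk'
    have hs : ∀ t : Triangle, d.fst ∈ t.1 → d.snd ∈ t.1 → k ∈ t.1 →
        ({d.fst, d.snd, k} : Finset Ico) = t.1 := by
      intro t h1 h2 hk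
      apply Finset.eq_of_subset_of_card_le
      · simp [Finset.insert_subset_iff, h1, h2, hk]
      · rw [t.2.card_eq, (is3Clique_triple_iff.2 ⟨d.adj, hk1, hk2⟩).card_eq]
    exact Subtype.ext ((hs t h1 h2 hk).symm.trans (hs t' h1' h2' hk'))
  rcases eq_turn _ _ d.adj k hk1 hk2 with rfl | rfl
  · exact Or.inl (key _ (fst_mem_tri d) (snd_mem_tri d) (turn_mem_tri d))
  · exact Or.inr (key _ (snd_mem_tri d.symm) (fst_mem_tri d.symm) (turn_mem_tri d.symm))

/-- A triangle lies to the left of exactly the three darts that run around it in one direction;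
their reversals have the neighbouring triangles on their left. This yields the three central
vertices of a hexagon. -/
theorem eq_of_tri_eq {d e : BVertex} (h : tri d = tri e) :
    e = d ∨ e = (next d).symm ∨ e = prev d.symm := by
  have hne : e.fst ≠ e.snd := e.adj.ne
  have key : ∀ c : BVertex, tri c = tri d → e ≠ c.symm := fun c hc he =>
    tri_ne_tri_symm c (hc.trans (h.trans (congrArg tri he)))
  have h0 := key d rfl
  have h1 := key _ (tri_symm_next d)
  have h2 := key _ (tri_prev_symm d)
  rcases mem_tri.1 (h ▸ fst_mem_tri e) with h3 | h3 | h3 <;>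
  rcases mem_tri.1 (h ▸ snd_mem_tri e) with h4 | h4 | h4
  · exact (hne (h3.trans h4.symm)).elim
  · exact Or.inl (dart_ext h3 h4)
  · exact (h1 (dart_ext h3 h4)).elim
  · exact (h0 (dart_ext h3 h4)).elim
  · exact (hne (h3.trans h4.symm)).elim
  · exact Or.inr (Or.inr (dart_ext h3 h4))
  · exact Or.inr (Or.inl (dart_ext h3 h4))
  · exact (h2 (dart_ext h3 h4)).elim
  · exact (hne (h3.trans h4.symm)).elim

theorem B_adj_next (d : BVertex) : B.Adj d (next d) := Or.inr ⟨rfl, (turn_spec _ _ d.adj).2.1⟩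

theorem B_adj_prev (d : BVertex) : B.Adj d (prev d) := Or.inr ⟨rfl, (turn_spec _ _ d.adj.symm).1⟩

theorem B_adj_symm (d : BVertex) : B.Adj d d.symm := Or.inl rfl

theorem B_adj_cases {d e : BVertex} (h : B.Adj d e) : e = d.symm ∨ e = next d ∨ e = prev d := by
  rcases h with rfl | ⟨h1, h2⟩
  · exact Or.inl rfl
  · refine Or.inr ?_
    rcases eq_turn _ _ d.adj e.snd (h1 ▸ e.adj) h2 with h | h
    · exact Or.inl (dart_ext h1.symm h)
    · exact Or.inr (dart_ext h1.symm h)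

/-- Each vertex of the truncated icosahedron lies on one pentagon and two hexagons, with two sides
in each. This accounts for the six corner kinds. -/
theorem side_cases {φ : Face} {d e : BVertex} (h : B.Adj d e) (hd : d ∈ φ.verts)
    (he : e ∈ φ.verts) : (φ = .pentagon d.fst ∧ (e = next d ∨ e = prev d)) ∨
      (φ = .hexagon (tri d) ∧ (e = next d ∨ e = d.symm)) ∨
      (φ = .hexagon (tri d.symm) ∧ (e = prev d ∨ e = d.symm)) := by
  have hde := B_adj_cases h
  rcases φ with i | t
  · obtain rfl : d.fst = i := hd
    refine Or.inl ⟨rfl, hde.resolve_left ?_⟩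
    rintro rfl
    exact symm_fst_ne d he
  · refine Or.inr ?_
    rcases eq_tri_or_eq_tri_symm hd.1 hd.2 with rfl | rfl
    · refine Or.inl ⟨rfl, ?_⟩
      rcases hde with rfl | rfl | rfl
      · exact Or.inr rfl
      · exact Or.inl rfl
      · exact (turn_not_mem_tri_symm d.symm he.2).elim
    · refine Or.inr ⟨rfl, ?_⟩
      rcases hde with rfl | rfl | rfl
      · exact Or.inr rfl
      · exact (turn_not_mem_tri_symm d he.2).elim
      · exact Or.inl rfl

/-! ### Parametrization of the vertices -/

theorem isSide_of_mem {φ : Face} {d e : BVertex} (h : B.Adj d e) (hd : d ∈ φ.verts)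
    (he : e ∈ φ.verts) : φ.IsSide s(d, e) :=
  ⟨h, fun v hv => by rcases Sym2.mem_iff.1 hv with rfl | rfl <;> assumption⟩

theorem mem_of_isSide {φ : Face} {d e : BVertex} (h : φ.IsSide s(d, e)) :
    B.Adj d e ∧ d ∈ φ.verts ∧ e ∈ φ.verts :=
  ⟨h.1, h.2 d (Sym2.mem_mk_left d e), h.2 e (Sym2.mem_mk_right d e)⟩

theorem pent_next (d : BVertex) : (Face.pentagon d.fst).IsSide s(d, next d) :=
  isSide_of_mem (B_adj_next d) rfl rfl

theorem pent_prev (d : BVertex) : (Face.pentagon d.fst).IsSide s(d, prev d) :=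
  isSide_of_mem (B_adj_prev d) rfl rfl

theorem hex_next (d : BVertex) : (Face.hexagon (tri d)).IsSide s(d, next d) :=
  isSide_of_mem (B_adj_next d) ⟨fst_mem_tri d, snd_mem_tri d⟩ ⟨fst_mem_tri d, turn_mem_tri d⟩

theorem hex_prev (d : BVertex) : (Face.hexagon (tri d.symm)).IsSide s(d, prev d) :=
  isSide_of_mem (B_adj_prev d) ⟨snd_mem_tri d.symm, fst_mem_tri d.symm⟩
    ⟨snd_mem_tri d.symm, turn_mem_tri d.symm⟩

theorem hex_symm (d : BVertex) : (Face.hexagon (tri d)).IsSide s(d, d.symm) :=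
  isSide_of_mem (B_adj_symm d) ⟨fst_mem_tri d, snd_mem_tri d⟩ ⟨snd_mem_tri d, fst_mem_tri d⟩

theorem hex_symm' (d : BVertex) : (Face.hexagon (tri d.symm)).IsSide s(d, d.symm) :=
  isSide_of_mem (B_adj_symm d) ⟨snd_mem_tri d.symm, fst_mem_tri d.symm⟩
    ⟨fst_mem_tri d.symm, snd_mem_tri d.symm⟩

def pentNextCorner (d : BVertex) : DirSide :=
  ⟨.pentagon d.fst, ⟨(d, next d), B_adj_next d⟩, pent_next d⟩

def pentPrevCorner (d : BVertex) : DirSide :=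
  ⟨.pentagon d.fst, ⟨(d, prev d), B_adj_prev d⟩, pent_prev d⟩

def hexNextCorner (d : BVertex) : DirSide :=
  ⟨.hexagon (tri d), ⟨(d, next d), B_adj_next d⟩, hex_next d⟩

def hexPrevCorner (d : BVertex) : DirSide :=
  ⟨.hexagon (tri d.symm), ⟨(d, prev d), B_adj_prev d⟩, hex_prev d⟩

def hexSymmLCorner (d : BVertex) : DirSide :=
  ⟨.hexagon (tri d), ⟨(d, d.symm), B_adj_symm d⟩, hex_symm d⟩

def hexSymmRCorner (d : BVertex) : DirSide :=
  ⟨.hexagon (tri d.symm), ⟨(d, d.symm), B_adj_symm d⟩, hex_symm' d⟩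

def pentSide (d : BVertex) : Side := ⟨_, _, pent_next d⟩

def hexSide (d : BVertex) : Side := ⟨_, _, hex_next d⟩

def symmSide (d : BVertex) : Side := ⟨_, _, hex_symm d⟩

def hexPentSide (d : BVertex) : HexPentSide := ⟨_, _, hex_next d, _, pent_next d⟩

/-- The vertex of a given kind at a given dart. -/
def vertexOf : Kind → BVertex → Vertex
  | .key, d => .key d
  | .pentNext, d => .corner (pentNextCorner d)
  | .pentPrev, d => .corner (pentPrevCorner d)
  | .hexNext, d => .corner (hexNextCorner d)
  | .hexPrev, d => .corner (hexPrevCorner d)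
  | .hexSymmL, d => .corner (hexSymmLCorner d)
  | .hexSymmR, d => .corner (hexSymmRCorner d)
  | .pentMid, d => .mid (pentSide d)
  | .hexMid, d => .mid (hexSide d)
  | .symmMid, d => .mid (symmSide d)
  | .spoke, d => .spoke (hexPentSide d)
  | .center, d => .center (hexPentSide d)

theorem corner_cases (a : DirSide) : ∃ d, a = pentNextCorner d ∨ a = pentPrevCorner d ∨
    a = hexNextCorner d ∨ a = hexPrevCorner d ∨ a = hexSymmLCorner d ∨ a = hexSymmRCorner d := by
  obtain ⟨φ, ⟨⟨d, e⟩, h⟩, hs⟩ := a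
  obtain ⟨h1 : B.Adj d e, h2 : d ∈ φ.verts, h3 : e ∈ φ.verts⟩ := mem_of_isSide hs
  refine ⟨d, ?_⟩
  rcases side_cases h1 h2 h3 with ⟨rfl, rfl | rfl⟩ | ⟨rfl, rfl | rfl⟩ | ⟨rfl, rfl | rfl⟩
  · exact Or.inl rfl
  · exact Or.inr (Or.inl rfl)
  · exact Or.inr (Or.inr (Or.inl rfl))
  · exact Or.inr (Or.inr (Or.inr (Or.inr (Or.inl rfl))))
  · exact Or.inr (Or.inr (Or.inr (Or.inl rfl)))
  · exact Or.inr (Or.inr (Or.inr (Or.inr (Or.inr rfl))))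

theorem Side.eq_of {s s' : Side} (h1 : s.face = s'.face) (h2 : s.edge = s'.edge) : s = s' := by
  cases s
  cases s'
  simp_all

theorem HexPentSide.eq_of {s s' : HexPentSide} (h1 : s.hex = s'.hex) (h2 : s.edge = s'.edge) :
    s = s' := by
  cases s
  cases s'
  simp_all

theorem edge_prev (d : BVertex) : s(d, prev d) = s(prev d, next (prev d)) := by
  rw [next_prev, Sym2.eq_swap]

/-- An undirected side gets a canonical dart. For a side along a pentagon it is the end from which
`next` leads to the other end; for a side between two hexagons it is the end, as a dart, that has
the given hexagon on its left. -/
theorem mid_cases (s : Side) : ∃ d, s = pentSide d ∨ s = hexSide d ∨ s = symmSide d := by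
  obtain ⟨φ, e, hs⟩ := s
  induction e using Sym2.ind with
  | _ d e =>
    obtain ⟨h1, h2, h3⟩ := mem_of_isSide hs
    rcases side_cases h1 h2 h3 with ⟨rfl, rfl | rfl⟩ | ⟨rfl, rfl | rfl⟩ | ⟨rfl, rfl | rfl⟩
    · exact ⟨d, Or.inl rfl⟩
    · exact ⟨prev d, Or.inl (Side.eq_of rfl (edge_prev d))⟩
    · exact ⟨d, Or.inr (Or.inl rfl)⟩
    · exact ⟨d, Or.inr (Or.inr rfl)⟩
    · exact ⟨prev d, Or.inr (Or.inl (Side.eq_of (congrArg Face.hexagon (tri_prev d).symm) (edge_prev d)))⟩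
    · refine ⟨d.symm, Or.inr (Or.inr (Side.eq_of rfl ?_))⟩
      change s(d, d.symm) = s(d.symm, d.symm.symm)
      rw [Dart.symm_symm, Sym2.eq_swap]

theorem hexPent_cases (s : HexPentSide) : ∃ d, s = hexPentSide d := by
  obtain ⟨t, e, hs, i, hi⟩ := s
  induction e using Sym2.ind with
  | _ d e =>
    obtain ⟨h1, h2, h3⟩ := mem_of_isSide hs
    obtain ⟨-, h4, h5⟩ := mem_of_isSide hi
    have hne : e ≠ d.symm := by
      rintro rfl
      exact symm_fst_ne d (Eq.trans h5 (Eq.symm h4))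
    rcases side_cases h1 h2 h3 with ⟨h, -⟩ | ⟨h, h' | h'⟩ | ⟨h, h' | h'⟩
    · cases h
    · cases h
      subst h'
      exact ⟨d, rfl⟩
    · exact (hne h').elim
    · cases h
      subst h'
      exact ⟨prev d, HexPentSide.eq_of (tri_prev d).symm (edge_prev d)⟩
    · exact (hne h').elim

theorem exists_vertexOf (v : Vertex) : ∃ k d, vertexOf k d = v := by
  rcases v with d | a | s | h | h
  · exact ⟨.key, d, rfl⟩
  · obtain ⟨d, rfl | rfl | rfl | rfl | rfl | rfl⟩ := corner_cases a
    · exact ⟨.pentNext, d, rfl⟩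
    · exact ⟨.pentPrev, d, rfl⟩
    · exact ⟨.hexNext, d, rfl⟩
    · exact ⟨.hexPrev, d, rfl⟩
    · exact ⟨.hexSymmL, d, rfl⟩
    · exact ⟨.hexSymmR, d, rfl⟩
  · obtain ⟨d, rfl | rfl | rfl⟩ := mid_cases s
    · exact ⟨.pentMid, d, rfl⟩
    · exact ⟨.hexMid, d, rfl⟩
    · exact ⟨.symmMid, d, rfl⟩
  · obtain ⟨d, rfl⟩ := hexPent_cases h
    exact ⟨.spoke, d, rfl⟩
  · obtain ⟨d, rfl⟩ := hexPent_cases h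
    exact ⟨.center, d, rfl⟩

theorem edge_next_inj {d e : BVertex} (h : s(d, next d) = s(e, next e)) : d = e := by
  rcases Sym2.eq_iff.1 h with ⟨h, -⟩ | ⟨h1, h2⟩
  · exact h
  · exact (next_next_ne e (by rw [← h1, h2])).elim

theorem edge_symm_inj {d e : BVertex} (h : s(d, d.symm) = s(e, e.symm)) :
    d = e ∨ d = e.symm := by
  rcases Sym2.eq_iff.1 h with ⟨h, -⟩ | ⟨h, -⟩
  · exact Or.inl h
  · exact Or.inr h

theorem edge_next_ne_edge_symm (d e : BVertex) : s(d, next d) ≠ s(e, e.symm) := fun h => by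
  rcases Sym2.eq_iff.1 h with ⟨rfl, h⟩ | ⟨rfl, h⟩
  · exact symm_fst_ne d (by rw [← h]; rfl)
  · exact symm_fst_ne e
      (congrArg (fun x : BVertex => x.fst) h : (next e.symm).fst = e.fst)

theorem edge_prev_ne_edge_symm (d e : BVertex) : s(d, prev d) ≠ s(e, e.symm) := by
  rw [edge_prev]
  exact edge_next_ne_edge_symm _ _

/-- Corners are told apart by face and direction. A middle between two hexagons has the same edge
for `d` and `d.symm`, but a different face, by `tri_ne_tri_symm`. -/
theorem vertexOf_inj {k k' : Kind} {d d' : BVertex} (h : vertexOf k d = vertexOf k' d') :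
    k = k' ∧ d = d' := by
  have corner : ∀ {a b : DirSide}, Vertex.corner a = .corner b →
      a.face = b.face ∧ a.dart.fst = b.dart.fst ∧ a.dart.snd = b.dart.snd := by
    intro a b h
    cases h
    exact ⟨rfl, rfl, rfl⟩
  have mid : ∀ {a b : Side}, Vertex.mid a = .mid b → a.face = b.face ∧ a.edge = b.edge := by
    intro a b h
    cases h
    exact ⟨rfl, rfl⟩
  have hp : ∀ {a b : HexPentSide}, a = b → a.edge = b.edge := fun h => congrArg _ h
  cases k <;> cases k' <;>
    first
    | (cases h; exact ⟨rfl, rfl⟩)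
    | cases h
    | (obtain ⟨h1, h2, h3⟩ := corner h
       obtain rfl : d = d' := h2
       first
       | exact ⟨rfl, rfl⟩
       | exact (Face.noConfusion h1).elim
       | exact (next_ne_prev d h3).elim
       | exact (next_ne_prev d h3.symm).elim
       | exact (next_ne_symm d d rfl h3).elim
       | exact (next_ne_symm d d rfl h3.symm).elim
       | exact (prev_ne_symm d h3).elim
       | exact (prev_ne_symm d h3.symm).elim
       | exact (tri_ne_tri_symm d (Face.hexagon.inj h1)).elim
       | exact (tri_ne_tri_symm d (Face.hexagon.inj h1).symm).elim)
    | (obtain ⟨h1, h2⟩ := mid h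
       first
       | exact (Face.noConfusion h1).elim
       | exact ⟨rfl, edge_next_inj h2⟩
       | exact (edge_next_ne_edge_symm _ _ h2).elim
       | exact (edge_next_ne_edge_symm _ _ h2.symm).elim
       | (rcases edge_symm_inj h2 with rfl | rfl
          · exact ⟨rfl, rfl⟩
          · exact (tri_ne_tri_symm _ (Face.hexagon.inj h1).symm).elim))
    | exact ⟨rfl, edge_next_inj (hp (Vertex.spoke.inj h))⟩
    | exact ⟨rfl, edge_next_inj (hp (Vertex.center.inj h))⟩

end Soccer

namespace Soccer

open SimpleGraph

/-! ### Adjacency -/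

theorem Link.ne {u v : Vertex} (h : Link u v) : u ≠ v := by
  rcases h with _ | ⟨_, _, _, _, hne⟩ | _ | ⟨_, _, _, hne⟩ | _ | _ | ⟨_, _, _, hne⟩
  · exact nofun
  · exact fun h => hne (Vertex.corner.inj h)
  · exact nofun
  · exact fun h => hne (Vertex.mid.inj h)
  · exact nofun
  · exact nofun
  · exact fun h => hne (Vertex.center.inj h)

theorem graph_adj {u v : Vertex} : graph.Adj u v ↔ Link u v ∨ Link v u := by
  rw [graph, fromRel_adj]
  exact ⟨And.right, fun h => ⟨h.elim Link.ne fun h => h.ne.symm, h⟩⟩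

/-- The neighbours of `vertexOf k d`. -/
def vertexNbrs (k : Kind) (d : BVertex) : List Vertex := nbrs next prev Dart.symm vertexOf k d

theorem link_pentNext_pentMid (d : BVertex) :
    Link (vertexOf .pentNext d) (vertexOf .pentMid d) :=
  .corner_mid (pentNextCorner d) (pentSide d) rfl rfl

theorem link_pentPrev_pentMid (d : BVertex) :
    Link (vertexOf .pentPrev d) (vertexOf .pentMid (prev d)) :=
  .corner_mid (pentPrevCorner d) (pentSide (prev d)) rfl (edge_prev d)

theorem link_hexNext_hexMid (d : BVertex) :
    Link (vertexOf .hexNext d) (vertexOf .hexMid d) :=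
  .corner_mid (hexNextCorner d) (hexSide d) rfl rfl

theorem link_hexPrev_hexMid (d : BVertex) :
    Link (vertexOf .hexPrev d) (vertexOf .hexMid (prev d)) :=
  .corner_mid (hexPrevCorner d) (hexSide (prev d)) (congrArg Face.hexagon (tri_prev d).symm)
    (edge_prev d)

theorem link_hexSymmL_symmMid (d : BVertex) :
    Link (vertexOf .hexSymmL d) (vertexOf .symmMid d) :=
  .corner_mid (hexSymmLCorner d) (symmSide d) rfl rfl

theorem link_hexSymmR_symmMid (d : BVertex) :
    Link (vertexOf .hexSymmR d) (vertexOf .symmMid d.symm) :=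
  .corner_mid (hexSymmRCorner d) (symmSide d.symm) rfl (by
    change s(d, d.symm) = s(d.symm, d.symm.symm)
    rw [Dart.symm_symm, Sym2.eq_swap])

theorem link_corner (k : Kind) (d : BVertex) :
    (∃ a, vertexOf k d = .corner a ∧ a.dart.fst = d) → Link (vertexOf .key d) (vertexOf k d) := by
  rintro ⟨a, h, rfl⟩
  rw [h]
  exact .key_corner a

theorem link_pent (d : BVertex) : Link (vertexOf .pentNext d) (vertexOf .pentPrev d) :=
  .corner_corner _ _ rfl rfl fun h => next_ne_prev d (congrArg (fun a => a.dart.snd) h)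

theorem link_hexL (d : BVertex) : Link (vertexOf .hexNext d) (vertexOf .hexSymmL d) :=
  .corner_corner _ _ rfl rfl fun h => next_ne_symm d d rfl (congrArg (fun a => a.dart.snd) h)

theorem link_hexR (d : BVertex) : Link (vertexOf .hexPrev d) (vertexOf .hexSymmR d) :=
  .corner_corner _ _ rfl rfl fun h => prev_ne_symm d (congrArg (fun a => a.dart.snd) h)

theorem link_pentMid_hexMid (d : BVertex) : Link (vertexOf .pentMid d) (vertexOf .hexMid d) :=
  .mid_mid _ _ rfl fun h => Face.noConfusion (congrArg Side.face h)

theorem link_symmMid (d : BVertex) : Link (vertexOf .symmMid d) (vertexOf .symmMid d.symm) :=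
  .mid_mid _ _ (by
    change s(d, d.symm) = s(d.symm, d.symm.symm)
    rw [Dart.symm_symm, Sym2.eq_swap]) fun h =>
      tri_ne_tri_symm d (Face.hexagon.inj (congrArg Side.face h))

theorem link_center {d e : BVertex} (h : tri d = tri e) (hne : d ≠ e) :
    Link (vertexOf .center d) (vertexOf .center e) :=
  .center_center _ _ h fun h' => hne (edge_next_inj (congrArg HexPentSide.edge h'))

theorem adj_of_mem_vertexNbrs {k : Kind} {d : BVertex} {v : Vertex} (h : v ∈ vertexNbrs k d) :
    graph.Adj (vertexOf k d) v := by
  rw [graph_adj]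
  cases k <;>
    simp only [vertexNbrs, nbrs, List.mem_cons, List.not_mem_nil, or_false] at h
  case key =>
    rcases h with rfl | rfl | rfl | rfl | rfl | rfl <;> exact Or.inl (link_corner _ d ⟨_, rfl, rfl⟩)
  case pentNext =>
    rcases h with rfl | rfl | rfl
    · exact Or.inr (link_corner _ d ⟨_, rfl, rfl⟩)
    · exact Or.inl (link_pent d)
    · exact Or.inl (link_pentNext_pentMid d)
  case pentPrev =>
    rcases h with rfl | rfl | rfl
    · exact Or.inr (link_corner _ d ⟨_, rfl, rfl⟩)
    · exact Or.inr (link_pent d)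
    · exact Or.inl (link_pentPrev_pentMid d)
  case hexNext =>
    rcases h with rfl | rfl | rfl
    · exact Or.inr (link_corner _ d ⟨_, rfl, rfl⟩)
    · exact Or.inl (link_hexL d)
    · exact Or.inl (link_hexNext_hexMid d)
  case hexPrev =>
    rcases h with rfl | rfl | rfl
    · exact Or.inr (link_corner _ d ⟨_, rfl, rfl⟩)
    · exact Or.inl (link_hexR d)
    · exact Or.inl (link_hexPrev_hexMid d)
  case hexSymmL =>
    rcases h with rfl | rfl | rfl
    · exact Or.inr (link_corner _ d ⟨_, rfl, rfl⟩)
    · exact Or.inr (link_hexL d)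
    · exact Or.inl (link_hexSymmL_symmMid d)
  case hexSymmR =>
    rcases h with rfl | rfl | rfl
    · exact Or.inr (link_corner _ d ⟨_, rfl, rfl⟩)
    · exact Or.inr (link_hexR d)
    · exact Or.inl (link_hexSymmR_symmMid d)
  case pentMid =>
    rcases h with rfl | rfl | rfl
    · exact Or.inr (link_pentNext_pentMid d)
    · exact Or.inr (by simpa using link_pentPrev_pentMid (next d))
    · exact Or.inl (link_pentMid_hexMid d)
  case hexMid =>
    rcases h with rfl | rfl | rfl | rfl
    · exact Or.inr (link_hexNext_hexMid d)
    · exact Or.inr (by simpa using link_hexPrev_hexMid (next d))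
    · exact Or.inr (link_pentMid_hexMid d)
    · exact Or.inl (.mid_spoke (hexPentSide d))
  case symmMid =>
    rcases h with rfl | rfl | rfl
    · exact Or.inr (link_hexSymmL_symmMid d)
    · exact Or.inr (by simpa using link_hexSymmR_symmMid d.symm)
    · exact Or.inl (link_symmMid d)
  case spoke =>
    rcases h with rfl | rfl
    · exact Or.inr (.mid_spoke (hexPentSide d))
    · exact Or.inl (.spoke_center (hexPentSide d))
  case center =>
    rcases h with rfl | rfl | rfl
    · exact Or.inr (.spoke_center (hexPentSide d))
    · refine Or.inl (link_center (tri_symm_next d).symm fun h => ?_)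
      exact d.adj.ne (congrArg (fun e : BVertex => e.snd) h).symm
    · refine Or.inl (link_center (tri_prev_symm d).symm fun h => ?_)
      exact d.adj.ne (congrArg (fun e : BVertex => e.fst) h)

/-- A link may be listed from either end; symmetry of the lists makes the direction irrelevant in
`graph_adj_vertexOf`. -/
theorem nbrs_symm {k k' : Kind} {d d' : BVertex} (h : vertexOf k' d' ∈ vertexNbrs k d) :
    vertexOf k d ∈ vertexNbrs k' d' := by
  cases k <;> simp only [vertexNbrs, nbrs, List.mem_cons, List.not_mem_nil, or_false] at h <;>
    repeat' (refine Or.elim h ?_ ?_ <;> clear h <;> intro h)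
  all_goals
    obtain ⟨rfl, rfl⟩ := vertexOf_inj h
    simp [vertexNbrs, nbrs]

theorem Face.pentagon_ne_hexagon {i : Ico} {t : Triangle} : Face.pentagon i ≠ .hexagon t := nofun

/-- Every link is an edge of the model. -/
theorem Link.exists {u v : Vertex} (h : Link u v) :
    ∃ k d, u = vertexOf k d ∧ v ∈ vertexNbrs k d := by
  -- Excludes links between the two hexagons on either side of the same dart.
  have hD : ∀ d e : BVertex, Face.hexagon (tri d) = .hexagon (tri e.symm) → d ≠ e := by
    rintro d _ h rfl
    exact tri_ne_tri_symm d (Face.hexagon.inj h)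
  rcases h with a | ⟨a, b, hf, hv, hne⟩ | ⟨a, s, hf, he⟩ | ⟨s, s', he, hne⟩ | h | h | ⟨h, h', hx, hne⟩
  · obtain ⟨d, rfl | rfl | rfl | rfl | rfl | rfl⟩ := corner_cases a <;>
      exact ⟨.key, d, rfl, by simp [vertexNbrs, nbrs, vertexOf]⟩
  · obtain ⟨d, ha⟩ := corner_cases a
    obtain ⟨e, hb⟩ := corner_cases b
    obtain rfl : d = e := by
      rcases ha with rfl | rfl | rfl | rfl | rfl | rfl <;>
        rcases hb with rfl | rfl | rfl | rfl | rfl | rfl <;> exact hv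
    rcases ha with rfl | rfl | rfl | rfl | rfl | rfl <;>
      rcases hb with rfl | rfl | rfl | rfl | rfl | rfl <;>
      first
      | exact (hne rfl).elim
      | exact (Face.pentagon_ne_hexagon hf).elim
      | exact (Face.pentagon_ne_hexagon hf.symm).elim
      | exact (hD d d hf rfl).elim
      | exact (hD d d hf.symm rfl).elim
      | exact ⟨.pentNext, d, rfl, by simp [vertexNbrs, nbrs, vertexOf]⟩
      | exact ⟨.pentPrev, d, rfl, by simp [vertexNbrs, nbrs, vertexOf]⟩
      | exact ⟨.hexNext, d, rfl, by simp [vertexNbrs, nbrs, vertexOf]⟩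
      | exact ⟨.hexPrev, d, rfl, by simp [vertexNbrs, nbrs, vertexOf]⟩
      | exact ⟨.hexSymmL, d, rfl, by simp [vertexNbrs, nbrs, vertexOf]⟩
      | exact ⟨.hexSymmR, d, rfl, by simp [vertexNbrs, nbrs, vertexOf]⟩
  · obtain ⟨d, rfl | rfl | rfl | rfl | rfl | rfl⟩ := corner_cases a <;>
      obtain ⟨e, rfl | rfl | rfl⟩ := mid_cases s <;>
      first
      | exact (Face.pentagon_ne_hexagon hf).elim
      | exact (Face.pentagon_ne_hexagon hf.symm).elim
      | exact (edge_next_ne_edge_symm _ _ he).elim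
      | exact (edge_next_ne_edge_symm _ _ he.symm).elim
      | exact (edge_prev_ne_edge_symm _ _ he).elim
      | (obtain rfl := edge_next_inj he
         first
         | exact ⟨.pentNext, d, rfl, by simp [vertexNbrs, nbrs, vertexOf]; rfl⟩
         | exact ⟨.hexNext, d, rfl, by simp [vertexNbrs, nbrs, vertexOf]; rfl⟩)
      | (obtain rfl := edge_next_inj ((edge_prev d).symm.trans he)
         first
         | exact ⟨.pentPrev, d, rfl, by simp [vertexNbrs, nbrs, vertexOf]⟩
         | exact ⟨.hexPrev, d, rfl, by simp [vertexNbrs, nbrs, vertexOf]⟩)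
      | (rcases edge_symm_inj he with rfl | rfl
         · first
           | exact ⟨.hexSymmL, _, rfl, by simp [vertexNbrs, nbrs, vertexOf]; rfl⟩
           | exact (hD _ _ hf.symm rfl).elim
         · first
           | exact (hD _ _ hf.symm rfl).elim
           | exact ⟨.hexSymmR, _, rfl, by simp [vertexNbrs, nbrs, vertexOf]⟩)
  · obtain ⟨d, rfl | rfl | rfl⟩ := mid_cases s <;>
      obtain ⟨e, rfl | rfl | rfl⟩ := mid_cases s' <;>
      first
      | exact (edge_next_ne_edge_symm _ _ he).elim
      | exact (edge_next_ne_edge_symm _ _ he.symm).elim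
      | (obtain rfl := edge_next_inj he
         first
         | exact (hne rfl).elim
         | exact ⟨.pentMid, d, rfl, by simp [vertexNbrs, nbrs, vertexOf]⟩
         | exact ⟨.hexMid, d, rfl, by simp [vertexNbrs, nbrs, vertexOf]⟩)
      | (rcases edge_symm_inj he with rfl | rfl
         · exact (hne rfl).elim
         · exact ⟨.symmMid, _, rfl, by simp [vertexNbrs, nbrs, vertexOf]⟩)
  · obtain ⟨d, rfl⟩ := hexPent_cases h
    exact ⟨.hexMid, d, rfl, by simp [vertexNbrs, nbrs, vertexOf]⟩
  · obtain ⟨d, rfl⟩ := hexPent_cases h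
    exact ⟨.spoke, d, rfl, by simp [vertexNbrs, nbrs, vertexOf]⟩
  · obtain ⟨d, rfl⟩ := hexPent_cases h
    obtain ⟨e, rfl⟩ := hexPent_cases h'
    refine ⟨.center, d, rfl, ?_⟩
    rcases eq_of_tri_eq hx with rfl | rfl | rfl
    · exact (hne rfl).elim
    · simp [vertexNbrs, nbrs, vertexOf]
    · simp [vertexNbrs, nbrs, vertexOf]

theorem graph_adj_vertexOf {k : Kind} {d : BVertex} {v : Vertex} :
    graph.Adj (vertexOf k d) v ↔ v ∈ vertexNbrs k d := by
  refine ⟨fun h => ?_, adj_of_mem_vertexNbrs⟩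
  rcases graph_adj.1 h with h | h
  · obtain ⟨k', d', h1, h2⟩ := h.exists
    obtain ⟨rfl, rfl⟩ := vertexOf_inj h1
    exact h2
  · obtain ⟨k', d', rfl, h2⟩ := h.exists
    exact nbrs_symm h2

end Soccer

namespace Soccer

open SimpleGraph

/-! ### Numbering the vertices -/

/-- A numbering of the vertices of the icosahedron. -/
def icoOf (i : ℕ) : Ico :=
  if i = 0 then (true, none) else if i < 6 then (true, some (i - 1 : ℕ))
  else if i < 11 then (false, some (i - 6 : ℕ)) else (false, none)

/-- The first of the five neighbours of a vertex of the icosahedron. -/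
def firstNbr : Ico → Ico
  | (true, none) => (true, some 0)
  | (true, some _) => (true, none)
  | (false, some _) => (false, none)
  | (false, none) => (false, some 0)

/-- The second vertex of the dart with number `n`. -/
def sndOf (n : ℕ) : Ico := (turn (icoOf (n / 5)))^[n % 5] (firstNbr (icoOf (n / 5)))

theorem adj_sndOf : ∀ n < 60, icosahedron.Adj (icoOf (n / 5)) (sndOf n) := by decide +kernel

theorem exists_sndOf : ∀ i j, icosahedron.Adj i j → ∃ n < 60, icoOf (n / 5) = i ∧ sndOf n = j := by
  decide +kernel

theorem sndOf_inj : ∀ m < 60, ∀ n < 60, icoOf (m / 5) = icoOf (n / 5) → sndOf m = sndOf n →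
    m = n := by
  decide +kernel

theorem sndOf_nxtN : ∀ n < 60, nxtN n < 60 ∧ icoOf (nxtN n / 5) = icoOf (n / 5) ∧
    sndOf (nxtN n) = turn (icoOf (n / 5)) (sndOf n) := by
  decide +kernel

theorem prvN_lt : ∀ n < 60, prvN n < 60 ∧ nxtN (prvN n) = n := by decide +kernel

theorem sndOf_symN : ∀ n < 60, symN n < 60 ∧ icoOf (symN n / 5) = sndOf n ∧
    sndOf (symN n) = icoOf (n / 5) := by
  decide +kernel

/-- The dart whose number is the residue of `n` modulo 60. -/
def dartOf (n : ℕ) : BVertex :=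
  ⟨(icoOf (n % 60 / 5), sndOf (n % 60)), adj_sndOf _ (Nat.mod_lt n (by norm_num))⟩

theorem dartOf_of_lt {n : ℕ} (h : n < 60) :
    (dartOf n).fst = icoOf (n / 5) ∧ (dartOf n).snd = sndOf n := by
  simp [dartOf, Nat.mod_eq_of_lt h]

theorem next_dartOf {n : ℕ} (h : n < 60) : next (dartOf n) = dartOf (nxtN n) := by
  obtain ⟨h1, h2, h3⟩ := sndOf_nxtN n h
  obtain ⟨h4, h5⟩ := dartOf_of_lt h
  obtain ⟨h6, h7⟩ := dartOf_of_lt h1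
  refine dart_ext ?_ ?_
  · exact h4.trans (h2.symm.trans h6.symm)
  · rw [h7, h3, ← h4, ← h5]
    rfl

theorem prev_dartOf {n : ℕ} (h : n < 60) : prev (dartOf n) = dartOf (prvN n) := by
  obtain ⟨h1, h2⟩ := prvN_lt n h
  rw [← prev_next (dartOf (prvN n)), next_dartOf h1, h2]

theorem symm_dartOf {n : ℕ} (h : n < 60) : (dartOf n).symm = dartOf (symN n) := by
  obtain ⟨h1, h2, h3⟩ := sndOf_symN n h
  obtain ⟨h4, h5⟩ := dartOf_of_lt h
  obtain ⟨h6, h7⟩ := dartOf_of_lt h1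
  refine dart_ext ?_ ?_
  · exact h5.trans (h2.symm.trans h6.symm)
  · exact h4.trans (h3.symm.trans h7.symm)

theorem exists_dartOf (d : BVertex) : ∃ n < 60, dartOf n = d := by
  obtain ⟨n, hn, h1, h2⟩ := exists_sndOf _ _ d.adj
  exact ⟨n, hn, dart_ext ((dartOf_of_lt hn).1.trans h1) ((dartOf_of_lt hn).2.trans h2)⟩

theorem dartOf_inj {m n : ℕ} (h : dartOf m = dartOf n) : m % 60 = n % 60 :=
  sndOf_inj _ (Nat.mod_lt m (by norm_num)) _ (Nat.mod_lt n (by norm_num))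
    (congrArg (fun d : BVertex => d.fst) h) (congrArg (fun d : BVertex => d.snd) h)

/-- The vertex with number `n`. -/
def vertexAt (n : ℕ) : Vertex := vertexOf (kindOf (n / 60)) (dartOf n)

theorem index_kindOf : ∀ i < 12, (kindOf i).index = i := by decide +kernel

theorem kindOf_index (k : Kind) : kindOf k.index = k := by cases k <;> rfl

theorem index_lt (k : Kind) : k.index < 12 := by cases k <;> decide

theorem vertexAt_mkN (k : Kind) {d : ℕ} (h : d < 60) :
    vertexAt (mkN k d) = vertexOf k (dartOf d) := by
  have h1 : mkN k d / 60 = k.index := by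
    change (60 * k.index + d) / 60 = _
    omega
  have h2 : mkN k d % 60 = d % 60 := by
    change (60 * k.index + d) % 60 = _
    omega
  simp only [vertexAt, dartOf, h1, h2, kindOf_index]

theorem mkN_lt (k : Kind) {d : ℕ} (h : d < 60) : mkN k d < 720 := by
  have := index_lt k
  change 60 * k.index + d < 720
  omega

theorem vertexNbrs_dartOf (k : Kind) {d : ℕ} (h : d < 60) :
    vertexNbrs k (dartOf d) = (nbrs nxtN prvN symN mkN k d).map vertexAt := by
  have h1 := (sndOf_nxtN d h).1
  have h2 := (prvN_lt d h).1
  have h3 := (sndOf_symN d h).1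
  have h4 := (sndOf_symN _ h1).1
  have h5 := (prvN_lt _ h3).1
  cases k <;>
    simp [vertexNbrs, nbrs, next_dartOf, prev_dartOf, symm_dartOf, vertexAt_mkN, h, h1, h2, h3, h4,
      h5]

/-! ### Charts -/

/-- A numbering of the vertices that identifies the graph with the numerical model. -/
structure IsChart (φ : ℕ → Vertex) : Prop where
  inj : ∀ m < 720, ∀ n < 720, φ m = φ n → m = n
  surj : ∀ v, ∃ n < 720, φ n = v
  adj : ∀ n < 720, ∀ v, graph.Adj (φ n) v ↔ ∃ m ∈ nb n, φ m = v
  key : ∀ n < 720, (∃ d, φ n = .key d) ↔ n < 60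

theorem isChart_vertexAt : IsChart vertexAt where
  inj m hm n hn h := by
    obtain ⟨h1, h2⟩ := vertexOf_inj h
    have h3 := dartOf_inj h2
    have h4 := congrArg Kind.index h1
    rw [index_kindOf _ (by omega), index_kindOf _ (by omega)] at h4
    omega
  surj v := by
    obtain ⟨k, d, rfl⟩ := exists_vertexOf v
    obtain ⟨n, hn, rfl⟩ := exists_dartOf d
    exact ⟨mkN k n, mkN_lt k hn, vertexAt_mkN k hn⟩
  adj n hn v := by
    have h : n % 60 < 60 := Nat.mod_lt n (by norm_num)
    have h1 : dartOf n = dartOf (n % 60) := by simp [dartOf]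
    rw [vertexAt, graph_adj_vertexOf, h1, vertexNbrs_dartOf _ h, List.mem_map, nb, withNat_eq]
    rfl
  key n hn := by
    constructor
    · rintro ⟨d, h⟩
      have h1 := congrArg Kind.index (vertexOf_inj (k' := .key) h).1
      rw [index_kindOf _ (by omega)] at h1
      change n / 60 = 0 at h1
      omega
    · intro h
      exact ⟨dartOf n, by rw [vertexAt, Nat.div_eq_of_lt h]; rfl⟩

/-- An automorphism of the numerical model of order dividing `k + 1`. -/
structure IsSymmetry (σ : ℕ → ℕ) (k : ℕ) : Prop where
  lt : ∀ n < 720, σ n < 720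
  iterate : ∀ n < 720, σ^[k + 1] n = n
  nb : ∀ n < 720, nb (σ n) = (nb n).map σ
  key : ∀ n < 720, σ n < 60 ↔ n < 60

theorem IsSymmetry.iterate_lt {σ : ℕ → ℕ} {k : ℕ} (h : IsSymmetry σ k) (j : ℕ) :
    ∀ n < 720, σ^[j] n < 720 := by
  induction j with
  | zero => exact fun _ => id
  | succ j ih => exact fun n hn => by rw [Function.iterate_succ_apply]; exact ih _ (h.lt n hn)

theorem IsChart.comp {φ : ℕ → Vertex} (hφ : IsChart φ) {σ : ℕ → ℕ} {k : ℕ} (h : IsSymmetry σ k) :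
    IsChart (φ ∘ σ) where
  inj m hm n hn he := by
    have := hφ.inj _ (h.lt m hm) _ (h.lt n hn) he
    rw [← h.iterate m hm, ← h.iterate n hn, Function.iterate_succ_apply, this,
      Function.iterate_succ_apply]
  surj v := by
    obtain ⟨n, hn, rfl⟩ := hφ.surj v
    -- Since the `(k + 1)`-st iterate is the identity, the `k`-th iterate is the inverse of `σ`.
    refine ⟨σ^[k] n, h.iterate_lt k n hn, ?_⟩
    rw [Function.comp_apply, ← Function.iterate_succ_apply' σ, h.iterate n hn]
  adj n hn v := by
    rw [Function.comp_apply, hφ.adj _ (h.lt n hn), h.nb n hn]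
    simp
  key n hn := by rw [Function.comp_apply, hφ.key _ (h.lt n hn), h.key n hn]

/-- The map of vertices with a given table of values on darts. -/
def onDarts (table n : ℕ) : ℕ :=
  Nat.add (Nat.mul 60 (Nat.div n 60)) (digit table (Nat.mod n 60))

/-- The rotation by a fifth of a turn around the first vertex of the icosahedron. -/
def rotation : ℕ → ℕ := onDarts
  0xeb9e37ee28607dedb5d33cb1c2fbadb2baa9a279a59232481c615d71b69961759551349140f38d30b280103081

/-- The half-turn that reverses the first dart. -/
def halfTurn : ℕ → ℕ := onDarts
  0xbeeb71c28b2baa9e37efae75d33cb655461759140f4d228e34c2e59239e67de8a181c6da65d103081009207185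

theorem isSymmetry_rotation : IsSymmetry rotation 4 where
  lt := by decide +kernel
  iterate := by decide +kernel
  nb := by decide +kernel
  key := by decide +kernel

theorem isSymmetry_halfTurn : IsSymmetry halfTurn 1 where
  lt := by decide +kernel
  iterate := by decide +kernel
  nb := by decide +kernel
  key := by decide +kernel

theorem IsChart.comp_iterate {φ : ℕ → Vertex} (hφ : IsChart φ) {σ : ℕ → ℕ} {k : ℕ}
    (h : IsSymmetry σ k) (j : ℕ) : IsChart (φ ∘ σ^[j]) := by
  induction j with
  | zero => exact hφ
  | succ j ih => exact ih.comp h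

/-- The word describes a walk of three edges in the icosahedron: turn `a` times, cross the edge,
turn `b` times, and so on. Any two vertices, even equal ones, are joined by a walk of length exactly
three, and the last turn selects the dart. -/
theorem exists_symmetry : ∀ n < 60, ∃ a < 5, ∃ b < 5, ∃ c < 5, ∃ d < 5,
    rotation^[a] (halfTurn (rotation^[b] (halfTurn (rotation^[c] (halfTurn (rotation^[d] 0)))))) =
      n := by
  decide +kernel

theorem exists_isChart_zero_eq (d : BVertex) : ∃ φ, IsChart φ ∧ φ 0 = .key d := by
  have hv := isChart_vertexAt
  obtain ⟨n, hn, h⟩ := hv.surj (.key d)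
  obtain ⟨i, -, j, -, k, -, l, -, h'⟩ := exists_symmetry n ((hv.key n hn).1 ⟨d, h⟩)
  refine ⟨_, (((((((hv.comp_iterate isSymmetry_rotation i).comp isSymmetry_halfTurn).comp_iterate
    isSymmetry_rotation j).comp isSymmetry_halfTurn).comp_iterate isSymmetry_rotation k).comp
    isSymmetry_halfTurn).comp_iterate isSymmetry_rotation l), ?_⟩
  simp only [Function.comp_apply, h', h]

end Soccer

namespace Soccer

open SimpleGraph CopsRobber

/-! ### The robber's strategy -/

/-- `v` is a key vertex. -/
def IsKey (v : Vertex) : Prop := ∃ d, v = .key d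

theorem IsChart.robberStep_iff {φ : ℕ → Vertex} (h : IsChart φ) {n : ℕ} (hn : n < 720) {v : Vertex} :
    RobberStep graph (φ n) v ↔ ∃ m, Near n m ∧ φ m = v := by
  rw [RobberStep, h.adj n hn]
  constructor
  · rintro (rfl | ⟨m, hm, rfl⟩)
    · exact ⟨n, .refl n, rfl⟩
    · exact ⟨m, Or.inr hm, rfl⟩
  · rintro ⟨m, rfl | hm, rfl⟩
    · exact Or.inl rfl
    · exact Or.inr ⟨m, hm, rfl⟩

theorem IsChart.ne {φ : ℕ → Vertex} (h : IsChart φ) {m n : ℕ} (hm : m < 720) (hn : n < 720)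
    (hne : m ≠ n) : φ m ≠ φ n :=
  fun he => hne (h.inj m hm n hn he)

theorem IsChart.robberStep_iff_near {φ : ℕ → Vertex} (h : IsChart φ) {m n : ℕ} (hm : m < 720)
    (hn : n < 720) : RobberStep graph (φ m) (φ n) ↔ Near m n := by
  rw [h.robberStep_iff hm]
  refine ⟨?_, fun h => ⟨n, h, rfl⟩⟩
  rintro ⟨k, hk, he⟩
  rwa [← h.inj k (hk.lt hm) n hn he]

theorem IsChart.escapes {φ : ℕ → Vertex} (h : IsChart φ) {x a b c : ℕ}
    (he : Escapes Near (· < 60) x a b c) (hx : x < 720) (ha : a < 720) (hb : b < 720)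
    (hc : c < 720) : Escapes (RobberStep graph) IsKey (φ x) (φ a) (φ b) (φ c) := by
  induction he with
  | arrived h1 h2 h3 h4 h5 h6 h7 =>
    refine .arrived ((h.key _ hx).2 h1) (h.ne ha hx h2) (h.ne hb hx h3) (h.ne hc hx h4) ?_ ?_ ?_ <;>
      simpa only [h.robberStep_iff_near, hx, ha, hb, hc]
  | move y h1 h2 h3 h4 h5 h6 h7 _ _ _ i1 i2 i3 =>
    have hy := h4.lt hx
    refine .move (φ y) (h.ne ha hx h1) (h.ne hb hx h2) (h.ne hc hx h3)
      ((h.robberStep_iff_near hx hy).2 h4) (h.ne ha hy h5) (h.ne hb hy h6) (h.ne hc hy h7) ?_ ?_ ?_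
    · intro v hv
      obtain ⟨n, hn, rfl⟩ := (h.robberStep_iff ha).1 hv
      exact i1 n hn hy (hn.lt ha) hb hc
    · intro v hv
      obtain ⟨n, hn, rfl⟩ := (h.robberStep_iff hb).1 hv
      exact i2 n hn hy ha (hn.lt hb) hc
    · intro v hv
      obtain ⟨n, hn, rfl⟩ := (h.robberStep_iff hc).1 hv
      exact i3 n hn hy ha hb (hn.lt hc)

theorem IsChart.advances {φ : ℕ → Vertex} (h : IsChart φ) {x a b c : ℕ}
    (he : Advances Near (· < 60) x a b c) (hx : x < 720) (ha : a < 720) (hb : b < 720)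
    (hc : c < 720) : Advances (RobberStep graph) IsKey (φ x) (φ a) (φ b) (φ c) := by
  obtain ⟨y, h1, h2, h3, h4, h5, h6, h7⟩ := he
  have hy := h1.lt hx
  refine ⟨φ y, (h.robberStep_iff_near hx hy).2 h1, h.ne ha hy h2, h.ne hb hy h3, h.ne hc hy h4,
    ?_, ?_, ?_⟩
  · intro v hv
    obtain ⟨n, hn, rfl⟩ := (h.robberStep_iff ha).1 hv
    exact h.escapes (h5 n hn) hy (hn.lt ha) hb hc
  · intro v hv
    obtain ⟨n, hn, rfl⟩ := (h.robberStep_iff hb).1 hv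
    exact h.escapes (h6 n hn) hy ha (hn.lt hb) hc
  · intro v hv
    obtain ⟨n, hn, rfl⟩ := (h.robberStep_iff hc).1 hv
    exact h.escapes (h7 n hn) hy ha hb (hn.lt hc)

/-- A chart that puts the robber's vertex at number `0` turns this into the case verified by
computation. -/
theorem advances_of_robberStep {x a b c : Vertex} (hx : IsKey x) (hax : a ≠ x)
    (ha : RobberStep graph x a) (hb : ¬ RobberStep graph x b) (hc : ¬ RobberStep graph x c) :
    Advances (RobberStep graph) IsKey x a b c := by
  obtain ⟨d, rfl⟩ := hx
  obtain ⟨φ, h, h0⟩ := exists_isChart_zero_eq d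
  obtain ⟨a, ha', rfl⟩ := h.surj a
  obtain ⟨b, hb', rfl⟩ := h.surj b
  obtain ⟨c, hc', rfl⟩ := h.surj c
  have h0' : 0 < 720 := by norm_num
  rw [← h0, h.robberStep_iff_near h0' (by assumption)] at ha hb hc
  rw [← h0]
  refine h.advances (advances_of_near (ha.resolve_left ?_) hb' hc' hb hc) h0' ha' hb' hc'
  rintro rfl
  exact hax h0

/-- The robber can stay at a key vertex that no cop threatens. -/
theorem advances_of_forall_not {x a b c : Vertex} (hx : IsKey x) (ha : ¬ RobberStep graph x a)
    (hb : ¬ RobberStep graph x b) (hc : ¬ RobberStep graph x c) :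
    Advances (RobberStep graph) IsKey x a b c := by
  have ne : ∀ {v}, ¬ RobberStep graph x v → v ≠ x := fun h h' => h (Or.inl h')
  have ne' : ∀ {v w}, ¬ RobberStep graph x v → RobberStep graph v w → w ≠ x := by
    rintro v _ h (rfl | h') rfl
    · exact h (Or.inl rfl)
    · exact h (Or.inr h'.symm)
  refine ⟨x, Or.inl rfl, ne ha, ne hb, ne hc, fun v hv => ?_, fun v hv => ?_, fun v hv => ?_⟩
  · exact .arrived hx (ne' ha hv) (ne hb) (ne hc) (fun h => hb h.2) (fun h => hc h.2) fun h => hb h.1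
  · exact .arrived hx (ne ha) (ne' hb hv) (ne hc) (fun h => ha h.1) (fun h => ha h.1) fun h => hc h.2
  · exact .arrived hx (ne ha) (ne hb) (ne' hc hv) (fun h => ha h.1) (fun h => ha h.1) fun h => hb h.1

/-- The key step of the invariant: a run in progress just continues, and on arrival a new one
begins, according to which cop, if any, is near. -/
theorem advances_of_escapes {x a b c : Vertex}
    (h : Escapes (RobberStep graph) IsKey x a b c) :
    Advances (RobberStep graph) IsKey x a b c := by
  cases h with
  | arrived hx h2 h3 h4 h5 h6 h7 =>
    by_cases ha : RobberStep graph x a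
    · exact advances_of_robberStep hx h2 ha (fun h => h5 ⟨ha, h⟩) fun h => h6 ⟨ha, h⟩
    by_cases hb : RobberStep graph x b
    · exact (advances_of_robberStep hx h3 hb ha fun h => h7 ⟨hb, h⟩).swap
    by_cases hc : RobberStep graph x c
    · exact (advances_of_robberStep hx h4 hc ha hb).swap.swap'
    · exact advances_of_forall_not hx ha hb hc
  | move y _ _ _ h4 h5 h6 h7 h8 h9 h10 => exact ⟨y, h4, h5, h6, h7, h8, h9, h10⟩

theorem Escapes.ne {α : Type*} {N : α → α → Prop} {key : α → Prop} {x a b c : α}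
    (h : Escapes N key x a b c) : a ≠ x ∧ b ≠ x ∧ c ≠ x := by
  cases h with
  | arrived _ h2 h3 h4 => exact ⟨h2, h3, h4⟩
  | move _ h2 h3 h4 => exact ⟨h2, h3, h4⟩

/-- In the one-cop-move game, all cops but one stay in place. -/
theorem exists_of_copStep {V : Type*} {G : SimpleGraph V} {n : ℕ} {p q : Fin (n + 1) → V}
    (h : CopStep G 1 p q) : ∃ i, RobberStep G (p i) (q i) ∧ ∀ j, j ≠ i → q j = p j := by
  obtain ⟨h1, h2⟩ := h
  by_cases h3 : ∃ i, q i ≠ p i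
  · obtain ⟨i, hi⟩ := h3
    refine ⟨i, h1 i, fun j hj => ?_⟩
    by_contra hj'
    exact hj ((Set.ncard_le_one (Set.toFinite _)).1 h2 j hj' i hi)
  · push Not at h3
    exact ⟨0, Or.inl (h3 0), fun j _ => h3 j⟩

theorem Advances.of_copStep {x : Vertex} {C : Fin 3 → Vertex}
    (h : Advances (RobberStep graph) IsKey x (C 0) (C 1) (C 2)) :
    ∃ s, RobberStep graph x s ∧ (∀ i, C i ≠ s) ∧ ∀ C', CopStep graph 1 C C' →
      Escapes (RobberStep graph) IsKey s (C' 0) (C' 1) (C' 2) := by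
  obtain ⟨s, h1, h2, h3, h4, h5, h6, h7⟩ := h
  refine ⟨s, h1, fun i => by fin_cases i <;> assumption, fun C' hC' => ?_⟩
  obtain ⟨i, hi, hj⟩ := exists_of_copStep hC'
  fin_cases i
  · rw [hj 1 (by decide), hj 2 (by decide)]
    exact h5 _ hi
  · rw [hj 0 (by decide), hj 2 (by decide)]
    exact h6 _ hi
  · rw [hj 0 (by decide), hj 1 (by decide)]
    exact h7 _ hi

/-- The closed neighbourhoods of four key vertices around one pentagon are disjoint, so one cop
threatens at most one of them. -/
theorem eq_of_near_of_near : ∀ x < 4, ∀ y < 4, ∀ m ∈ x :: nb x, m ∈ y :: nb y → x = y := by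
  decide +kernel

/-- Three cops cannot threaten all key vertices. -/
theorem exists_isKey_forall_not (C : Fin 3 → Vertex) :
    ∃ x, IsKey x ∧ ∀ i, ¬ RobberStep graph x (C i) := by
  have hφ := isChart_vertexAt
  by_contra! h
  have h' : ∀ x : Fin 4, ∃ i, RobberStep graph (vertexAt x) (C i) := fun x =>
    h _ ((hφ.key x (by omega)).2 (by omega))
  choose f hf using h'
  obtain ⟨x, y, hxy, he⟩ := Fintype.exists_ne_map_eq_of_card_lt f (by simp)
  have hx := hf x
  have hy := hf y
  rw [← he] at hy
  obtain ⟨m, hm, h1⟩ := hφ.surj (C (f x))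
  rw [← h1, hφ.robberStep_iff_near (by omega) hm] at hx hy
  exact hxy (Fin.ext (eq_of_near_of_near x x.2 y y.2 m (List.mem_cons.2 hx) (List.mem_cons.2 hy)))

theorem robberWins_graph : RobberWins graph 1 3 := by
  refine robberWins_of_invariant
    (fun r C => Escapes (RobberStep graph) IsKey r (C 0) (C 1) (C 2)) ?_ ?_ ?_
  · intro r C h i
    obtain ⟨h0, h1, h2⟩ := h.ne
    fin_cases i <;> assumption
  · intro C
    obtain ⟨x, hx, h⟩ := exists_isKey_forall_not C
    -- The initial placement is the target of a move that the robber could make from the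
    -- unthreatened vertex `x`.
    obtain ⟨s, -, hs⟩ := (advances_of_forall_not hx (h 0) (h 1) (h 2)).of_copStep
    exact ⟨s, hs⟩
  · exact fun r C h => (advances_of_escapes h).of_copStep

theorem card_vertex : Nat.card Vertex = 720 := by
  have hφ := isChart_vertexAt
  have h : Function.Bijective fun n : Fin 720 => vertexAt n := by
    refine ⟨fun m n h => Fin.ext (hφ.inj m m.2 n n.2 h), fun v => ?_⟩
    obtain ⟨n, hn, h⟩ := hφ.surj v
    exact ⟨⟨n, hn⟩, h⟩
  rw [← Nat.card_eq_of_bijective _ h, Nat.card_fin]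

end Soccer

theorem mainTheorem1 :
    Nat.card Soccer.Vertex = 720 ∧
      CopsRobber.RobberWins Soccer.graph 1 3 ∧
      3 < CopsRobber.copNumber Soccer.graph 1 :=
  ⟨Soccer.card_vertex, Soccer.robberWins_graph,
    Soccer.robberWins_graph.lt_copNumber (Soccer.vertexAt 0)⟩
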